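/- For an integer $n\ge 1$ let $\Vert n\Vert$ denote its complexity, i.e. the least number of $1$'s needed to write $n$ using only $1$, $+$, $\times$ and parentheses. Let $E$ be the function computed by the following procedure (all quotients of integers are rounded down): $E(0)=1$, and for $n\ge1$: set $r:=1$; while $n>4$ replace $r$ by $3r$ and $n$ by $n-3$; return $r\cdot n$. Consider the following algorithm with input an integer $N\ge 1$, which fills an array $\mathrm{Compl}[0..N]$. 1. Set $\mathrm{cMax}:=\lfloor 3\log N/\log 2\rfloor+1$, set all $\mathrm{Compl}[0],\dots,\mathrm{Compl}[N]$ to $\mathrm{cMax}$, then set $\mathrm{Compl}[1]:=1$. 2. For $n=2,3,\dots,N$ in this order: - (usual best value) if $\mathrm{Compl}[n-1]+1<\mathrm{Compl}[n]$, set $\mathrm{Compl}[n]:=\mathrm{Compl}[n-1]+1$; - (computing kMax) set $T:=\mathrm{Compl}[n-1]$ and $t:=\lfloor T/2\rfloor$; while $E(t)+E(T-t)<n$ replace $t$ by $t-1$; set $\mathrm{kMax}:=E(t)$; - (testing the sums) for $m=6,\dots,\mathrm{kMax}$: if $\mathrm{Compl}[m]+\mathrm{Compl}[n-m]<\mathrm{Compl}[n]$,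 set $\mathrm{Compl}[n]:=\mathrm{Compl}[m]+\mathrm{Compl}[n-m]$; - (testing the products) for $k=2,\dots,\min(n,\lfloor N/n\rfloor)$: if $\mathrm{Compl}[k]+\mathrm{Compl}[n]<\mathrm{Compl}[kn]$, set $\mathrm{Compl}[kn]:=\mathrm{Compl}[k]+\mathrm{Compl}[n]$. The algorithm is run on a random access machine with finitely many registers and one array, written as a program of elementary instructions (assignment; addition, subtraction, multiplication, integer division; reading, writing or appending an array entry; comparison), where $\mathrm{cMax}$ is obtained as the number of binary digits of $N^3$ by repeated halving. Time is the number of elementary instructions executed, and space is the maximum over the run of the number of bits occupied by the registers and the array, the array being stored with cells of a common width. **Theorem.** For every $N\ge 1$ the algorithm terminates without a fault (no negative difference, no division by zero, no array index out of range) with $\mathrm{Compl}[n]=\Vert n\Vert$ for all $1\le n\le N$. As $N\to\infty$ it runs in time $O(N^{1.230175})$ and space $O(N\log\log N)$, and all numbers stored during the run have $O(\log N)$ bits. -/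

import Mathlib

open scoped Asymptotics

/-! ### Integer complexity -/

/-- Expressions built from `1` with `+` and `×`. -/
inductive OneExpr : Type
  | one : OneExpr
  | add : OneExpr → OneExpr → OneExpr
  | mul : OneExpr → OneExpr → OneExpr

/-- The positive integer that an expression denotes. -/
def OneExpr.value : OneExpr → ℕ
  | .one => 1
  | .add a b => a.value + b.value
  | .mul a b => a.value * b.value

/-- The number of `1`'s written in an expression. -/
def OneExpr.ones : OneExpr → ℕ
  | .one => 1
  | .add a b => a.ones + b.ones
  | .mul a b => a.ones + b.ones

/-- The complexity `‖n‖` of an integer `n ≥ 1`: the least number of `1`'s in an expression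
for `n`. (It is only used for `n ≥ 1`.) -/
noncomputable def intComplexity (n : ℕ) : ℕ :=
  sInf {k | ∃ e : OneExpr, e.value = n ∧ e.ones = k}

/-! ### A random access machine with structured control

The memory consists of finitely many registers and one growable array of natural numbers.
Programs are in three-address form, so that every intermediate value lies in a register. -/

/-- The registers of the machine. -/
inductive Reg : Type
  | nMax | lim | cMax | q | j | n | d | a | c | target | t | u | e₁ | e₂ | s
  | kMax | m | k | bound | idx | arg | res
  deriving DecidableEq

instance : Fintype Reg where
  elems := {.nMax, .lim, .cMax, .q, .j, .n, .d, .a, .c, .target, .t, .u, .e₁, .e₂, .s,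
    .kMax, .m, .k, .bound, .idx, .arg, .res}
  complete := by intro r; cases r <;> decide

/-- An operand: the content of a register, or a constant of the program text. -/
inductive Opd : Type
  | reg : Reg → Opd
  | lit : ℕ → Opd

/-- The arithmetic operations; `div` is `⌊x / y⌋`. -/
inductive ArithOp : Type
  | add | sub | mul | div

/-- Subtraction faults on a negative result and division faults on a zero divisor. -/
def ArithOp.eval : ArithOp → ℕ → ℕ → Option ℕ
  | .add, x, y => some (x + y)
  | .sub, x, y => if y ≤ x then some (x - y) else none
  | .mul, x, y => some (x * y)
  | .div, x, y => if y = 0 then none else some (x / y)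

/-- A memory state: the registers, and the array (written `Compl`). -/
structure Mem : Type where
  reg : Reg → ℕ
  arr : List ℕ

/-- The value of an operand. -/
def Mem.val (σ : Mem) : Opd → ℕ
  | .reg r => σ.reg r
  | .lit v => v

/-- Overwrite one register. -/
def Mem.put (σ : Mem) (r : Reg) (v : ℕ) : Mem :=
  { σ with reg := Function.update σ.reg r v }

/-- The elementary instructions. -/
inductive Instr : Type
  /-- `r := x` -/
  | move (r : Reg) (x : Opd)
  /-- `r := x op y` -/
  | arith (r : Reg) (op : ArithOp) (x y : Opd)
  /-- `r := Compl[i]` -/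
  | load (r : Reg) (i : Opd)
  /-- `Compl[i] := x` -/
  | store (i x : Opd)
  /-- append `x` at the end of `Compl` -/
  | push (x : Opd)

/-- Execution of an elementary instruction; `none` is a fault (an arithmetic fault, or an
array index out of range). -/
def Instr.eval (σ : Mem) : Instr → Option Mem
  | .move r x => some (σ.put r (σ.val x))
  | .arith r op x y => (op.eval (σ.val x) (σ.val y)).map (σ.put r)
  | .load r i => (σ.arr[σ.val i]?).map (σ.put r)
  | .store i x =>
      if σ.val i < σ.arr.length then
        some { σ with arr := σ.arr.set (σ.val i) (σ.val x) }
      else none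
  | .push x => some { σ with arr := σ.arr ++ [σ.val x] }

/-- Programs. The only tests are comparisons `x < y`. -/
inductive Prog : Type
  | skip : Prog
  | instr : Instr → Prog
  | seq : Prog → Prog → Prog
  | ifLt (x y : Opd) (p q : Prog) : Prog
  | whileLt (x y : Opd) (p : Prog) : Prog

/-- The number of bits that store a natural number (at least one). -/
def bitLen (v : ℕ) : ℕ := max 1 v.size

/-- The cell width that the array needs: the bit length of its largest entry. -/
def Mem.cellWidth (σ : Mem) : ℕ := (σ.arr.map bitLen).foldr max 0

/-- The number of bits that a memory state occupies: the registers, and the array with cells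
of a common width. -/
def Mem.bits (σ : Mem) : ℕ :=
  (∑ r : Reg, bitLen (σ.reg r)) + σ.arr.length * σ.cellWidth

/-- The bit length of the largest number in a memory state. -/
def Mem.width (σ : Mem) : ℕ :=
  max (Finset.univ.sup fun r : Reg => bitLen (σ.reg r)) σ.cellWidth

/-- The resources used by a run: the number of elementary operations, the largest number of
bits occupied at any moment, and the bit length of the largest number ever stored. -/
@[ext]
structure Usage : Type where
  time : ℕ
  space : ℕ
  width : ℕ

/-- One operation carried out in the state `σ`. -/
def Usage.tick (σ : Mem) : Usage := ⟨1, σ.bits, σ.width⟩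

/-- Being in the state `σ`, without an operation. -/
def Usage.rest (σ : Mem) : Usage := ⟨0, σ.bits, σ.width⟩

/-- Resources of two consecutive parts of a run: times add up, peaks are maximized. -/
def Usage.andThen (α β : Usage) : Usage :=
  ⟨α.time + β.time, max α.space β.space, max α.width β.width⟩

/-- `Exec p σ τ ρ`: the program `p`, started in `σ`, terminates without a fault in `τ` and uses
the resources `ρ`. Every elementary instruction and every evaluation of a test costs one unit
of time. -/
inductive Exec : Prog → Mem → Mem → Usage → Prop
  | skip (σ : Mem) : Exec .skip σ σ (.rest σ)
  | instr (i : Instr) (σ τ : Mem) (h : i.eval σ = some τ) :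
      Exec (.instr i) σ τ ((Usage.tick σ).andThen (.rest τ))
  | seq (p q : Prog) (σ τ υ : Mem) (α β : Usage)
      (hp : Exec p σ τ α) (hq : Exec q τ υ β) :
      Exec (.seq p q) σ υ (α.andThen β)
  | ifTrue (x y : Opd) (p q : Prog) (σ τ : Mem) (α : Usage)
      (h : σ.val x < σ.val y) (hp : Exec p σ τ α) :
      Exec (.ifLt x y p q) σ τ ((Usage.tick σ).andThen α)
  | ifFalse (x y : Opd) (p q : Prog) (σ τ : Mem) (α : Usage)
      (h : ¬ σ.val x < σ.val y) (hq : Exec q σ τ α) :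
      Exec (.ifLt x y p q) σ τ ((Usage.tick σ).andThen α)
  | whileTrue (x y : Opd) (p : Prog) (σ τ υ : Mem) (α β : Usage)
      (h : σ.val x < σ.val y) (hp : Exec p σ τ α) (hw : Exec (.whileLt x y p) τ υ β) :
      Exec (.whileLt x y p) σ υ ((Usage.tick σ).andThen (α.andThen β))
  | whileFalse (x y : Opd) (p : Prog) (σ : Mem) (h : ¬ σ.val x < σ.val y) :
      Exec (.whileLt x y p) σ σ (.tick σ)

/-- The final state and the resources are determined by the program and the initial state. -/
theorem Exec.det {p : Prog} {σ τ τ' : Mem} {α α' : Usage}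
    (h : Exec p σ τ α) (h' : Exec p σ τ' α') : τ = τ' ∧ α = α' := by
  induction h generalizing τ' α' <;> cases h' <;> grind

/-! ### The time-improved algorithm -/

namespace TimeImproved

/-- Sequential composition of a list of programs. -/
def block : List Prog → Prog
  | [] => .skip
  | p :: ps => .seq p (block ps)

/-- The content of a register, as an operand. -/
def R (r : Reg) : Opd := .reg r

/-- A constant, as an operand. -/
def K (v : ℕ) : Opd := .lit v

def move (r : Reg) (x : Opd) : Prog := .instr (.move r x)
def add (r : Reg) (x y : Opd) : Prog := .instr (.arith r .add x y)
def sub (r : Reg) (x y : Opd) : Prog := .instr (.arith r .sub x y)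
def mul (r : Reg) (x y : Opd) : Prog := .instr (.arith r .mul x y)
def div (r : Reg) (x y : Opd) : Prog := .instr (.arith r .div x y)
def load (r : Reg) (i : Opd) : Prog := .instr (.load r i)
def store (i x : Opd) : Prog := .instr (.store i x)
def push (x : Opd) : Prog := .instr (.push x)

open Reg

/-- `out := E(x)`, the function `E` being computed as follows:
`E(0) = 1`; otherwise `result = 1; while n > 4: result *= 3; n -= 3; return result * n`. -/
def computeE (out : Reg) (x : Reg) : Prog :=
  .ifLt (R x) (K 1)
    (move out (K 1))
    (block [
      move res (K 1),
      move arg (R x),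
      .whileLt (K 4) (R arg) (block [
        mul res (R res) (K 3),
        sub arg (R arg) (K 3)]),
      mul out (R res) (R arg)])

/-- `cMax := ⌊3 log nMax / log 2⌋ + 1` (this is the number of binary digits of `nMax ^ 3`),
`Compl := [cMax for n in range(0, nMax + 1)]`, `Compl[1] := 1`. -/
def initCompl : Prog :=
  block [
    add lim (R nMax) (K 1),
    mul q (R nMax) (R nMax),
    mul q (R q) (R nMax),
    move cMax (K 0),
    .whileLt (K 0) (R q) (block [
      div q (R q) (K 2),
      add cMax (R cMax) (K 1)]),
    move j (K 0),
    .whileLt (R j) (R lim) (block [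
      push (R cMax),
      add j (R j) (K 1)]),
    store (K 1) (K 1)]

/-- `a := Compl[n-1] + 1; if a < Compl[n]: Compl[n] := a`. -/
def usualBestValue : Prog :=
  block [
    sub d (R n) (K 1),
    load a (R d),
    add a (R a) (K 1),
    load c (R n),
    .ifLt (R a) (R c) (store (R n) (R a)) .skip]

/-- `s := E(t) + E(target - t)`. -/
def sumOfE : Prog :=
  block [
    computeE e₁ t,
    sub u (R target) (R t),
    computeE e₂ u,
    add s (R e₁) (R e₂)]

/-- `target := Compl[n-1]; t := target / 2; while E(t) + E(target - t) < n: t := t - 1;`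
`kMax := E(t)`. -/
def computeKMax : Prog :=
  block [
    sub d (R n) (K 1),
    load target (R d),
    div t (R target) (K 2),
    sumOfE,
    .whileLt (R s) (R n) (block [
      sub t (R t) (K 1),
      sumOfE]),
    computeE kMax t]

/-- `for m in range(6, kMax + 1): if Compl[m] + Compl[n-m] < Compl[n]:`
`Compl[n] := Compl[m] + Compl[n-m]`. -/
def testSums : Prog :=
  block [
    add bound (R kMax) (K 1),
    move m (K 6),
    .whileLt (R m) (R bound) (block [
      load a (R m),
      sub d (R n) (R m),
      load c (R d),
      add a (R a) (R c),
      load c (R n),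
      .ifLt (R a) (R c) (store (R n) (R a)) .skip,
      add m (R m) (K 1)])]

/-- `for k in range(2, min(n, nMax / n) + 1): if Compl[k] + Compl[n] < Compl[k * n]:`
`Compl[k * n] := Compl[k] + Compl[n]`. -/
def testProducts : Prog :=
  block [
    div bound (R nMax) (R n),
    .ifLt (R n) (R bound) (move bound (R n)) .skip,
    add bound (R bound) (K 1),
    move k (K 2),
    .whileLt (R k) (R bound) (block [
      load a (R k),
      load c (R n),
      add a (R a) (R c),
      mul idx (R k) (R n),
      load c (R idx),
      .ifLt (R a) (R c) (store (R idx) (R a)) .skip,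
      add k (R k) (K 1)])]

/-- The whole algorithm: after the initialization, one main loop over `n` in
`range(2, nMax + 1)`. -/
def program : Prog :=
  block [
    initCompl,
    move n (K 2),
    .whileLt (R n) (R lim) (block [
      usualBestValue,
      computeKMax,
      testSums,
      testProducts,
      add n (R n) (K 1)])]

/-- The initial memory: the input `N` in the register `nMax`, all other registers `0`, and an
empty array. -/
def input (N : ℕ) : Mem where
  reg := fun r => if r = nMax then N else 0
  arr := []

end TimeImproved

/-!
Correctness. Let `E(k)` be the largest integer that can be written with `k` ones. If `a + b = n`
and `‖a‖ + ‖b‖ ≤ ‖n - 1‖`, then `n ≤ E(‖a‖) + E(‖b‖)`, so the smaller of `a` and `b` is at most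
`kMax`. Any other sum is no better than `‖n - 1‖ + 1`.

Running time. Since `E(s) E(t) ≤ E(s + t)`, testing the sums takes
`kMax ≤ 2 E(‖n - 1‖) / n ≤ 2 * 3 ^ (‖n - 1‖ / 3) / (n - 1)` rounds, and all other steps together
take time `O(N log² N)`. It remains to bound the sum of `3 ^ (‖n‖ / 3) / n` over `n ≤ N`. For
`p = 2` and `p = 3`, `‖n‖ ≤ ‖n / p‖ + p + n % p`, so the summand for `n` is at most that for
`n / p` times `3 ^ ((p + n % p) / 3) / p`. This gives linear recursive inequalities for the sums
over the residue classes modulo 18, and a positive vector that these inequalities contract at the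
exponent `1.23` proves the bound `O(N ^ 1.23)` by induction.
-/

/-! ### Integer complexity -/

theorem OneExpr.ones_pos (e : OneExpr) : 1 ≤ e.ones := by
  induction e <;> simp only [OneExpr.ones] <;> omega

theorem OneExpr.value_pos (e : OneExpr) : 1 ≤ e.value := by
  induction e with
  | one => exact le_rfl
  | add a b iha _ => exact iha.trans (Nat.le_add_right _ _)
  | mul a b iha ihb => exact Nat.mul_pos iha ihb

theorem OneExpr.intComplexity_value_le (e : OneExpr) : intComplexity e.value ≤ e.ones :=
  Nat.sInf_le ⟨e, rfl, rfl⟩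

theorem OneExpr.exists_value_eq {n : ℕ} (hn : 1 ≤ n) : ∃ e : OneExpr, e.value = n := by
  induction n, hn using Nat.le_induction with
  | base => exact ⟨.one, rfl⟩
  | succ n _ ih =>
    obtain ⟨e, rfl⟩ := ih
    exact ⟨.add e .one, rfl⟩

theorem OneExpr.exists_ones_eq_intComplexity {n : ℕ} (hn : 1 ≤ n) :
    ∃ e : OneExpr, e.value = n ∧ e.ones = intComplexity n := by
  obtain ⟨e, he⟩ := exists_value_eq hn
  exact Nat.sInf_mem (s := {k | ∃ e : OneExpr, e.value = n ∧ e.ones = k}) ⟨e.ones, e, he, rfl⟩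

theorem intComplexity_pos {n : ℕ} (hn : 1 ≤ n) : 1 ≤ intComplexity n := by
  obtain ⟨e, -, he⟩ := OneExpr.exists_ones_eq_intComplexity hn
  exact he ▸ e.ones_pos

theorem intComplexity_one : intComplexity 1 = 1 :=
  le_antisymm (OneExpr.intComplexity_value_le .one) (intComplexity_pos le_rfl)

theorem intComplexity_add_le {a b : ℕ} (ha : 1 ≤ a) (hb : 1 ≤ b) :
    intComplexity (a + b) ≤ intComplexity a + intComplexity b := by
  obtain ⟨x, rfl, hx⟩ := OneExpr.exists_ones_eq_intComplexity ha
  obtain ⟨y, rfl, hy⟩ := OneExpr.exists_ones_eq_intComplexity hb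
  rw [← hx, ← hy]
  exact (OneExpr.add x y).intComplexity_value_le

theorem intComplexity_mul_le {a b : ℕ} (ha : 1 ≤ a) (hb : 1 ≤ b) :
    intComplexity (a * b) ≤ intComplexity a + intComplexity b := by
  obtain ⟨x, rfl, hx⟩ := OneExpr.exists_ones_eq_intComplexity ha
  obtain ⟨y, rfl, hy⟩ := OneExpr.exists_ones_eq_intComplexity hb
  rw [← hx, ← hy]
  exact (OneExpr.mul x y).intComplexity_value_le

theorem intComplexity_add_right_le {n : ℕ} (hn : 1 ≤ n) (k : ℕ) :
    intComplexity (n + k) ≤ intComplexity n + k := by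
  induction k with
  | zero => rfl
  | succ k ih =>
    have := intComplexity_add_le (hn.trans (Nat.le_add_right n k)) le_rfl
    rw [intComplexity_one] at this
    exact this.trans (Nat.succ_le_succ ih)

theorem intComplexity_le_pred_add_one {n : ℕ} (hn : 2 ≤ n) :
    intComplexity n ≤ intComplexity (n - 1) + 1 := by
  simpa only [Nat.sub_add_cancel (Nat.one_le_of_lt hn)] using
    intComplexity_add_right_le (Nat.le_sub_one_of_lt hn) 1

theorem intComplexity_le_self {n : ℕ} (hn : 1 ≤ n) : intComplexity n ≤ n := by
  simpa only [intComplexity_one, Nat.add_sub_cancel' hn] using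
    intComplexity_add_right_le le_rfl (n - 1)

theorem exists_intComplexity_eq_add {n : ℕ} (hn : 2 ≤ n) :
    ∃ a b, 1 ≤ a ∧ a ≤ b ∧ (a + b = n ∨ 2 ≤ a ∧ a * b = n) ∧
      intComplexity a + intComplexity b = intComplexity n := by
  suffices h : ∃ a b, 1 ≤ a ∧ 1 ≤ b ∧ (a + b = n ∨ 2 ≤ a ∧ 2 ≤ b ∧ a * b = n) ∧
      intComplexity a + intComplexity b = intComplexity n by
    obtain ⟨a, b, ha, hb, hn, hc⟩ := h
    rcases le_total a b with hab | hab
    · exact ⟨a, b, ha, hab, hn.imp_right fun h => ⟨h.1, h.2.2⟩, hc⟩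
    · rw [add_comm] at hc
      exact ⟨b, a, hb, hab, hn.imp (add_comm b a ▸ ·) fun h => ⟨h.2.1, mul_comm b a ▸ h.2.2⟩, hc⟩
  obtain ⟨e, rfl, ho⟩ := OneExpr.exists_ones_eq_intComplexity (n := n) (by omega)
  cases e with
  | one => exact absurd hn (by decide)
  | add x y =>
    refine ⟨_, _, x.value_pos, y.value_pos, .inl rfl, le_antisymm ?_ ?_⟩
    · exact ho ▸ add_le_add x.intComplexity_value_le y.intComplexity_value_le
    · exact intComplexity_add_le x.value_pos y.value_pos
  | mul x y =>
    simp only [OneExpr.value, OneExpr.ones] at ho ⊢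
    have hxo := x.ones_pos
    have hyo := y.ones_pos
    have hx : x.value ≠ 1 := fun h => by
      have := y.intComplexity_value_le
      rw [h, one_mul] at ho
      omega
    have hy : y.value ≠ 1 := fun h => by
      have := x.intComplexity_value_le
      rw [h, mul_one] at ho
      omega
    have hx1 := x.value_pos
    have hy1 := y.value_pos
    refine ⟨_, _, hx1, hy1, .inr ⟨by omega, by omega, rfl⟩, le_antisymm ?_ ?_⟩
    · exact ho ▸ add_le_add x.intComplexity_value_le y.intComplexity_value_le
    · exact intComplexity_mul_le hx1 hy1

theorem intComplexity_le_div_add {p n : ℕ} (hp : 1 ≤ p) (hn : p ≤ n) :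
    intComplexity n ≤ intComplexity (n / p) + (p + n % p) := by
  have hq : 1 ≤ n / p := Nat.div_pos hn hp
  have hmul := intComplexity_mul_le hp hq
  have hadd := intComplexity_add_right_le (Nat.mul_pos hp hq) (n % p)
  rw [Nat.div_add_mod] at hadd
  have := intComplexity_le_self hp
  omega

/-- Each binary digit of `n` after the first costs at most three `1`'s. -/
theorem two_pow_intComplexity_le {n : ℕ} (hn : 2 ≤ n) : 2 ^ intComplexity n ≤ n ^ 3 := by
  induction n using Nat.strong_induction_on with
  | _ n ih =>
    rcases lt_or_ge n 4 with h4 | h4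
    · refine (Nat.pow_le_pow_right two_pos (intComplexity_le_self (by omega))).trans ?_
      interval_cases n <;> norm_num
    · have hdiv := intComplexity_le_div_add (p := 2) (by norm_num) hn
      calc 2 ^ intComplexity n ≤ 2 ^ (intComplexity (n / 2) + 3) :=
            Nat.pow_le_pow_right two_pos (by omega)
        _ = 2 ^ intComplexity (n / 2) * 2 ^ 3 := pow_add ..
        _ ≤ (n / 2) ^ 3 * 2 ^ 3 := Nat.mul_le_mul_right _ (ih (n / 2) (by omega) (by omega))
        _ = (n / 2 * 2) ^ 3 := (mul_pow ..).symm
        _ ≤ n ^ 3 := Nat.pow_le_pow_left (Nat.div_mul_le_self n 2) 3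

theorem intComplexity_le_size_pow_three {n N : ℕ} (hn : 1 ≤ n) (hN : n ≤ N) :
    intComplexity n ≤ (N ^ 3).size := by
  rcases hn.eq_or_lt with rfl | hn
  · rw [intComplexity_one]
    exact Nat.size_pos.2 (by positivity)
  · refine ((Nat.pow_lt_pow_iff_right one_lt_two).1 ?_).le
    exact ((two_pow_intComplexity_le hn).trans (Nat.pow_le_pow_left hN 3)).trans_lt
      (Nat.lt_size_self _)

/-! ### The largest integer of a given complexity -/

/-- The function `E` that the procedure computes: `maxVal k` is the largest integer that can be
written with `k` ones if `k ≥ 1`, and `maxVal 0 = 1`. -/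
def maxVal : ℕ → ℕ
  | 0 => 1
  | 1 => 1
  | 2 => 2
  | 3 => 3
  | 4 => 4
  | k + 5 => 3 * maxVal (k + 2)

theorem maxVal_add_three {k : ℕ} (hk : 2 ≤ k) : maxVal (k + 3) = 3 * maxVal k := by
  obtain ⟨k, rfl⟩ := Nat.exists_eq_add_of_le' hk
  rfl

theorem maxVal_eq_three_mul {k : ℕ} (hk : 5 ≤ k) : maxVal k = 3 * maxVal (k - 3) := by
  rw [← maxVal_add_three (by omega), Nat.sub_add_cancel (by omega)]

theorem maxVal_eq_self {k : ℕ} (h1 : 1 ≤ k) (h4 : k ≤ 4) : maxVal k = k := by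
  interval_cases k <;> rfl

theorem maxVal_pos (k : ℕ) : 1 ≤ maxVal k := by
  induction k using maxVal.induct <;> simp only [maxVal] <;> omega

theorem maxVal_lt_succ {k : ℕ} (hk : 1 ≤ k) : maxVal k < maxVal (k + 1) := by
  induction k using maxVal.induct with
  | case1 => contradiction
  | case6 k ih =>
    have := ih (by omega)
    rw [maxVal, maxVal_eq_three_mul (k := k + 5 + 1) (by omega)]
    simpa using this
  | _ => decide

theorem maxVal_mono : Monotone maxVal := by
  refine monotone_nat_of_le_succ fun k => ?_
  rcases k.eq_zero_or_pos with rfl | hk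
  · decide
  · exact (maxVal_lt_succ hk).le

theorem maxVal_mul_le (a b : ℕ) : maxVal a * maxVal b ≤ maxVal (a + b) := by
  induction hs : a + b using Nat.strong_induction_on generalizing a b with
  | _ s ih =>
    subst hs
    wlog hab : b ≤ a generalizing a b
    · rw [mul_comm, add_comm a b]
      exact this b a (fun m hm c d h => ih m (by omega) c d h) (by omega)
    rcases lt_or_ge a 5 with ha | ha
    · interval_cases a <;> interval_cases b <;> decide
    · rw [maxVal_eq_three_mul ha, maxVal_eq_three_mul (k := a + b) (by omega), mul_assoc]
      exact Nat.mul_le_mul_left 3 (ih _ (by omega) (a - 3) b (by omega))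

theorem maxVal_add_le {a b : ℕ} (ha : 1 ≤ a) (hb : 1 ≤ b) :
    maxVal a + maxVal b ≤ maxVal (a + b) := by
  rcases ha.eq_or_lt with rfl | ha
  · have := maxVal_lt_succ hb
    rwa [add_comm 1 b, add_comm]
  rcases hb.eq_or_lt with rfl | hb
  · exact maxVal_lt_succ (by omega)
  · exact (Nat.add_le_mul (maxVal_mono ha) (maxVal_mono hb)).trans (maxVal_mul_le a b)

theorem OneExpr.value_le_maxVal_ones (e : OneExpr) : e.value ≤ maxVal e.ones := by
  induction e with
  | one => exact le_rfl
  | add a b iha ihb => exact (add_le_add iha ihb).trans (maxVal_add_le a.ones_pos b.ones_pos)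
  | mul a b iha ihb => exact (Nat.mul_le_mul iha ihb).trans (maxVal_mul_le _ _)

theorem le_maxVal_intComplexity {n : ℕ} (hn : 1 ≤ n) : n ≤ maxVal (intComplexity n) := by
  obtain ⟨e, hv, ho⟩ := OneExpr.exists_ones_eq_intComplexity hn
  simpa only [hv, ho] using e.value_le_maxVal_ones

theorem maxVal_pow_three_le (k : ℕ) : maxVal k ^ 3 ≤ 3 ^ k := by
  induction k using maxVal.induct with
  | case6 k ih =>
    calc maxVal (k + 5) ^ 3 = 27 * maxVal (k + 2) ^ 3 := by rw [maxVal]; ring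
      _ ≤ 27 * 3 ^ (k + 2) := Nat.mul_le_mul_left _ ih
      _ = 3 ^ (k + 5) := by ring
  | _ => decide

theorem maxVal_intComplexity_le_sq {n : ℕ} (hn : 1 ≤ n) : maxVal (intComplexity n) ≤ n ^ 2 := by
  rcases hn.eq_or_lt with rfl | hn
  · rw [intComplexity_one]; decide
  · refine (Nat.pow_le_pow_iff_left three_ne_zero).1 ?_
    calc maxVal (intComplexity n) ^ 3 ≤ 3 ^ intComplexity n := maxVal_pow_three_le _
      _ ≤ (2 ^ 2) ^ intComplexity n := Nat.pow_le_pow_left (by norm_num) _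
      _ = (2 ^ intComplexity n) ^ 2 := by rw [← pow_mul, ← pow_mul, mul_comm]
      _ ≤ (n ^ 3) ^ 2 := Nat.pow_le_pow_left (two_pow_intComplexity_le hn) 2
      _ = (n ^ 2) ^ 3 := by ring

theorem maxVal_le_of_two_mul_le_intComplexity {n t : ℕ} (hn : 1 ≤ n)
    (ht : 2 * t ≤ intComplexity n) : maxVal t ≤ n := by
  refine (Nat.pow_le_pow_iff_left two_ne_zero).1 ?_
  calc maxVal t ^ 2 = maxVal t * maxVal t := sq _
    _ ≤ maxVal (t + t) := maxVal_mul_le _ _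
    _ ≤ maxVal (intComplexity n) := maxVal_mono (by omega)
    _ ≤ n ^ 2 := maxVal_intComplexity_le_sq hn

theorem le_intComplexity_of_le_five {n : ℕ} (h1 : 1 ≤ n) (h5 : n ≤ 5) : n ≤ intComplexity n := by
  by_contra! hlt
  have hle : n ≤ maxVal (n - 1) := (le_maxVal_intComplexity h1).trans (maxVal_mono (by omega))
  have hpos := intComplexity_pos h1
  rw [maxVal_eq_self (by omega) (by omega)] at hle
  omega

/-! ### The summands that have to be tested -/

/-- `t` is the value at which the computation of `kMax` stops: the largest `t ≤ ‖n - 1‖ / 2` with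
`E(t) + E(‖n - 1‖ - t) ≥ n`. -/
structure IsSumCutoff (n t : ℕ) : Prop where
  two_mul_le : 2 * t ≤ intComplexity (n - 1)
  le_add : n ≤ maxVal t + maxVal (intComplexity (n - 1) - t)
  add_lt : ∀ s, t < s → 2 * s ≤ intComplexity (n - 1) →
    maxVal s + maxVal (intComplexity (n - 1) - s) < n

namespace IsSumCutoff

variable {n t : ℕ}

theorem maxVal_lt (h : IsSumCutoff n t) (hn : 2 ≤ n) : maxVal t < n := by
  have := maxVal_le_of_two_mul_le_intComplexity (n := n - 1) (by omega) h.two_mul_le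
  omega

theorem maxVal_le_div (h : IsSumCutoff n t) (hn : 1 ≤ n) :
    maxVal t ≤ 2 * maxVal (intComplexity (n - 1)) / n := by
  have htc := h.two_mul_le
  have hadd := h.le_add
  generalize intComplexity (n - 1) = c at htc hadd ⊢
  have hle : n ≤ 2 * maxVal (c - t) := by
    have : maxVal t ≤ maxVal (c - t) := maxVal_mono (by omega)
    omega
  rw [Nat.le_div_iff_mul_le hn]
  calc maxVal t * n ≤ maxVal t * (2 * maxVal (c - t)) := Nat.mul_le_mul_left _ hle
    _ = 2 * (maxVal t * maxVal (c - t)) := mul_left_comm ..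
    _ ≤ 2 * maxVal (t + (c - t)) := Nat.mul_le_mul_left _ (maxVal_mul_le _ _)
    _ = 2 * maxVal c := by rw [Nat.add_sub_cancel' (by omega)]

theorem le_maxVal (h : IsSumCutoff n t) {a b : ℕ} (ha : 1 ≤ a) (hab : a ≤ b) (hn : a + b = n)
    (hc : intComplexity a + intComplexity b ≤ intComplexity (n - 1)) : a ≤ maxVal t := by
  have hA := le_maxVal_intComplexity ha
  have hB := le_maxVal_intComplexity (ha.trans hab)
  have le_of_add_le : ∀ s u, s ≤ u → s + u ≤ intComplexity (n - 1) →
      n ≤ maxVal s + maxVal u → s ≤ t := fun s u hsu hs hle => by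
    by_contra! hts
    have := h.add_lt s hts (by omega)
    have : maxVal u ≤ maxVal (intComplexity (n - 1) - s) := maxVal_mono (by omega)
    omega
  rcases le_total (intComplexity a) (intComplexity b) with hle | hle
  · exact hA.trans (maxVal_mono (le_of_add_le _ _ hle hc (by omega)))
  · exact hab.trans (hB.trans (maxVal_mono (le_of_add_le _ _ hle (by omega) (by omega))))

/-- Summands below `6` satisfy `‖a‖ = a`, so that `b + a` is no better than adding `1` to
`n - 1 = b + (a - 1)`. -/
theorem le_intComplexity (h : IsSumCutoff n t) (hn : 2 ≤ n) {v : ℕ}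
    (hsucc : v ≤ intComplexity (n - 1) + 1)
    (hsum : ∀ m, 6 ≤ m → m ≤ maxVal t → v ≤ intComplexity m + intComplexity (n - m))
    (hprod : ∀ a b, 2 ≤ a → a ≤ b → a * b = n → v ≤ intComplexity a + intComplexity b) :
    v ≤ intComplexity n := by
  obtain ⟨a, b, ha, hab, hsplit | ⟨ha2, hmul⟩, hc⟩ := exists_intComplexity_eq_add hn
  · by_contra! hlt
    have hat := h.le_maxVal ha hab hsplit (by omega)
    rcases lt_or_ge a 6 with h6 | h6
    · have hself := le_intComplexity_of_le_five ha (by omega)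
      have hpred := intComplexity_add_right_le (ha.trans hab) (a - 1)
      rw [show b + (a - 1) = n - 1 by omega] at hpred
      omega
    · have := hsum a h6 hat
      rw [show n - a = b by omega] at this
      omega
  · exact (hprod a b ha2 hab hmul).trans hc.le

end IsSumCutoff

/-! ### Hoare triples with resource bounds -/

theorem bitLen_mono : Monotone bitLen := fun _ _ h => max_le_max le_rfl (Nat.size_le_size h)

/-- Bounds for the content of a memory state. The registers are large enough for the sum of two
array entries. -/
structure Limits : Type where
  /-- bound for the registers -/
  val : ℕ
  /-- bound for the length of the array -/
  len : ℕ
  /-- bound for the entries of the array -/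
  cell : ℕ
  two_mul_cell_le : 2 * cell ≤ val

/-- The number of bits that a memory state obeying the limits can occupy. -/
def Limits.space (l : Limits) : ℕ := Fintype.card Reg * bitLen l.val + l.len * bitLen l.cell

/-- The bit length of the largest number that the limits allow. -/
def Limits.width (l : Limits) : ℕ := bitLen l.val

theorem Limits.cell_le_val (l : Limits) : l.cell ≤ l.val := by
  have := l.two_mul_cell_le
  omega

namespace Mem

@[simp] theorem put_arr (σ : Mem) (r : Reg) (v : ℕ) : (σ.put r v).arr = σ.arr := rfl

@[simp] theorem put_reg (σ : Mem) (r r' : Reg) (v : ℕ) :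
    (σ.put r v).reg r' = if r' = r then v else σ.reg r' :=
  Function.update_apply ..

theorem cellWidth_le_iff {σ : Mem} {w : ℕ} : σ.cellWidth ≤ w ↔ ∀ x ∈ σ.arr, bitLen x ≤ w := by
  unfold cellWidth
  induction σ.arr <;> simp_all

/-- The memory state obeys the limits. -/
structure Within (l : Limits) (σ : Mem) : Prop where
  reg_le : ∀ r, σ.reg r ≤ l.val
  length_le : σ.arr.length ≤ l.len
  mem_le : ∀ x ∈ σ.arr, x ≤ l.cell

namespace Within

variable {l : Limits} {σ : Mem}

theorem cellWidth_le (h : σ.Within l) : σ.cellWidth ≤ bitLen l.cell :=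
  cellWidth_le_iff.2 fun x hx => bitLen_mono (h.mem_le x hx)

theorem bits_le (h : σ.Within l) : σ.bits ≤ l.space := by
  refine add_le_add ?_ (Nat.mul_le_mul h.length_le h.cellWidth_le)
  exact Finset.sum_le_card_nsmul _ _ _ fun r _ => bitLen_mono (h.reg_le r)

theorem width_le (h : σ.Within l) : σ.width ≤ l.width :=
  max_le (Finset.sup_le fun r _ => bitLen_mono (h.reg_le r))
    (h.cellWidth_le.trans (bitLen_mono l.cell_le_val))

theorem put (h : σ.Within l) (r : Reg) {v : ℕ} (hv : v ≤ l.val) : (σ.put r v).Within l where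
  reg_le r' := by
    rw [put_reg]
    split_ifs
    exacts [hv, h.reg_le r']
  length_le := h.length_le
  mem_le := h.mem_le

theorem set (h : σ.Within l) (i : ℕ) {v : ℕ} (hv : v ≤ l.cell) :
    Within l ⟨σ.reg, σ.arr.set i v⟩ where
  reg_le := h.reg_le
  length_le := by simpa only [List.length_set] using h.length_le
  mem_le x hx := (List.mem_or_eq_of_mem_set hx).elim (h.mem_le x) fun h => h ▸ hv

theorem append (h : σ.Within l) (hlen : σ.arr.length < l.len) {v : ℕ} (hv : v ≤ l.cell) :
    Within l ⟨σ.reg, σ.arr ++ [v]⟩ where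
  reg_le := h.reg_le
  length_le := by
    rw [List.length_append, List.length_singleton]
    exact hlen
  mem_le x hx := (List.mem_append.1 hx).elim (h.mem_le x) fun h => List.mem_singleton.1 h ▸ hv

end Within

end Mem

/-- The registers to which an instruction assigns. -/
def Instr.targets : Instr → Finset Reg
  | .move r _ | .arith r _ _ _ | .load r _ => {r}
  | .store _ _ | .push _ => ∅

/-- The registers to which a program may assign. All other registers keep their values, which is
used as a frame rule. -/
def Prog.targets : Prog → Finset Reg
  | .skip => ∅
  | .instr i => i.targets
  | .seq p q | .ifLt _ _ p q => p.targets ∪ q.targets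
  | .whileLt _ _ p => p.targets

theorem Instr.reg_eq_of_notMem_targets {i : Instr} {σ τ : Mem} (h : i.eval σ = some τ) {r : Reg}
    (hr : r ∉ i.targets) : τ.reg r = σ.reg r := by
  cases i with
  | store i x =>
    obtain ⟨-, h⟩ := Option.ite_none_right_eq_some.1 h
    obtain rfl := Option.some.inj h
    rfl
  | push x =>
    obtain rfl := Option.some.inj h
    rfl
  | move r' x =>
    obtain rfl := Option.some.inj h
    rw [Mem.put_reg, if_neg (by simpa only [targets, Finset.mem_singleton] using hr)]
  | _ =>
    obtain ⟨v, -, rfl⟩ := Option.map_eq_some_iff.1 h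
    rw [Mem.put_reg, if_neg (by simpa only [targets, Finset.mem_singleton] using hr)]

theorem Exec.reg_eq_of_notMem_targets {p : Prog} {σ τ : Mem} {ρ : Usage} (h : Exec p σ τ ρ)
    {r : Reg} (hr : r ∉ p.targets) : τ.reg r = σ.reg r := by
  induction h with
  | skip | whileFalse => rfl
  | instr i _ _ h => exact i.reg_eq_of_notMem_targets h hr
  | seq _ _ _ _ _ _ _ _ _ ihp ihq =>
    rw [Prog.targets, Finset.mem_union, not_or] at hr
    exact (ihq hr.2).trans (ihp hr.1)
  | ifTrue _ _ _ _ _ _ _ _ _ ih =>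
    rw [Prog.targets, Finset.mem_union, not_or] at hr
    exact ih hr.1
  | ifFalse _ _ _ _ _ _ _ _ _ ih =>
    rw [Prog.targets, Finset.mem_union, not_or] at hr
    exact ih hr.2
  | whileTrue _ _ _ _ _ _ _ _ _ _ _ ihp ihw => exact (ihw hr).trans (ihp hr)

/-- Started in `σ`, which obeys the limits `l`, the program terminates without a fault in a state
with property `Q`, takes at most `T` steps, and obeys the limits all the time. -/
def Runs (l : Limits) (p : Prog) (σ : Mem) (T : ℕ) (Q : Mem → Prop) : Prop :=
  σ.Within l → ∃ τ ρ, Exec p σ τ ρ ∧ ρ.time ≤ T ∧ ρ.space ≤ l.space ∧ ρ.width ≤ l.width ∧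
    τ.Within l ∧ Q τ

namespace Runs

variable {l : Limits} {p q : Prog} {σ τ : Mem} {T T' : ℕ} {P Q Q' : Mem → Prop} {x y : Opd}

theorem of_within (h : σ.Within l → Runs l p σ T Q) : Runs l p σ T Q := fun hσ => h hσ hσ

theorem mono (h : Runs l p σ T Q) (hT : T ≤ T')
    (hQ : ∀ τ, (∀ r ∉ p.targets, τ.reg r = σ.reg r) → Q τ → Q' τ) : Runs l p σ T' Q' := by
  intro hσ
  obtain ⟨τ, ρ, he, ht, hs, hw, hl, hq⟩ := h hσ
  exact ⟨τ, ρ, he, ht.trans hT, hs, hw, hl, hQ τ (fun _ => he.reg_eq_of_notMem_targets) hq⟩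

theorem of_le (h : Runs l p σ T Q) (hT : T ≤ T') : Runs l p σ T' Q := h.mono hT fun _ _ h => h

theorem skip (hQ : Q σ) : Runs l .skip σ T Q :=
  fun hσ => ⟨σ, _, .skip σ, Nat.zero_le _, hσ.bits_le, hσ.width_le, hσ, hQ⟩

theorem instr {i : Instr} (h : i.eval σ = some τ) (hτ : σ.Within l → τ.Within l) (hQ : Q τ) :
    Runs l (.instr i) σ (T + 1) Q :=
  fun hσ => ⟨τ, _, .instr i σ τ h, Nat.le_add_left 1 T, max_le hσ.bits_le (hτ hσ).bits_le,
    max_le hσ.width_le (hτ hσ).width_le, hτ hσ, hQ⟩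

theorem seq (hp : Runs l p σ T P)
    (hq : ∀ τ, (∀ r ∉ p.targets, τ.reg r = σ.reg r) → P τ → Runs l q τ T' Q) :
    Runs l (.seq p q) σ (T + T') Q := by
  intro hσ
  obtain ⟨τ, ρ, he, ht, hs, hw, hl, hP⟩ := hp hσ
  obtain ⟨υ, ρ', he', ht', hs', hw', hl', hQ⟩ :=
    hq τ (fun _ => he.reg_eq_of_notMem_targets) hP hl
  exact ⟨υ, _, .seq p q σ τ υ ρ ρ' he he', add_le_add ht ht', max_le hs hs', max_le hw hw', hl', hQ⟩

theorem ifLt (hp : σ.val x < σ.val y → Runs l p σ T Q) (hq : σ.val y ≤ σ.val x → Runs l q σ T Q) :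
    Runs l (.ifLt x y p q) σ (T + 1) Q := by
  intro hσ
  rw [add_comm]
  by_cases h : σ.val x < σ.val y
  · obtain ⟨τ, ρ, he, ht, hs, hw, hl, hQ⟩ := hp h hσ
    exact ⟨τ, _, .ifTrue x y p q σ τ ρ h he, Nat.add_le_add_left ht 1, max_le hσ.bits_le hs,
      max_le hσ.width_le hw, hl, hQ⟩
  · obtain ⟨τ, ρ, he, ht, hs, hw, hl, hQ⟩ := hq (not_lt.1 h) hσ
    exact ⟨τ, _, .ifFalse x y p q σ τ ρ h he, Nat.add_le_add_left ht 1, max_le hσ.bits_le hs,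
      max_le hσ.width_le hw, hl, hQ⟩

/-- The potential `pot` pays for the rounds, and so bounds their number. -/
theorem whileLt {Inv : Mem → Prop} (pot : Mem → ℕ)
    (hbody : ∀ τ, (∀ r ∉ p.targets, τ.reg r = σ.reg r) → Inv τ → τ.val x < τ.val y →
      ∃ T, Runs l p τ T fun υ => Inv υ ∧ T + 1 + pot υ ≤ pot τ) (hI : Inv σ) :
    Runs l (.whileLt x y p) σ (pot σ + 1) fun τ => Inv τ ∧ τ.val y ≤ τ.val x := by
  suffices h : ∀ τ, (∀ r ∉ p.targets, τ.reg r = σ.reg r) → Inv τ →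
      Runs l (.whileLt x y p) τ (pot τ + 1) fun τ => Inv τ ∧ τ.val y ≤ τ.val x from
    h σ (fun _ _ => rfl) hI
  intro τ
  induction hn : pot τ using Nat.strong_induction_on generalizing τ with
  | _ n ih =>
    subst hn
    intro hfr hτ hl
    by_cases hxy : τ.val x < τ.val y
    · obtain ⟨T, hT⟩ := hbody τ hfr hτ hxy
      obtain ⟨υ, ρ, he, ht, hs, hw, hl', hυ, hpot⟩ := hT hl
      obtain ⟨φ, ρ', he', ht', hs', hw', hl'', hφ⟩ := ih (pot υ) (by omega) υ rfl
        (fun r hr => (he.reg_eq_of_notMem_targets hr).trans (hfr r hr)) hυ hl'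
      refine ⟨φ, _, .whileTrue x y p τ υ φ ρ ρ' hxy he he', ?_, max_le hl.bits_le (max_le hs hs'),
        max_le hl.width_le (max_le hw hw'), hl'', hφ⟩
      simp only [Usage.andThen, Usage.tick]
      omega
    · exact ⟨τ, _, .whileFalse x y p τ hxy, Nat.le_add_left 1 _, hl.bits_le, hl.width_le, hl, hτ,
        not_lt.1 hxy⟩

open TimeImproved

theorem forLt {r b : Reg} {lo hi : ℕ} {cost : ℕ → ℕ} {Inv : ℕ → Mem → Prop} (hb : b ∉ p.targets)
    (hbody : ∀ i, lo ≤ i → i < hi → ∀ τ, (∀ r ∉ p.targets, τ.reg r = σ.reg r) → τ.reg r = i →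
      Inv i τ → Runs l p τ (cost i) fun υ => υ.reg r = i + 1 ∧ Inv (i + 1) υ)
    (hlo : σ.reg r = lo) (hhi : σ.reg b = hi) (hI : Inv lo σ) :
    Runs l (.whileLt (R r) (R b) p) σ (∑ i ∈ Finset.Ico lo hi, (cost i + 1) + 1)
      (Inv (max lo hi)) := by
  have hwhile := whileLt (l := l) (p := p) (x := R r) (y := R b)
    (Inv := fun τ => lo ≤ τ.reg r ∧ τ.reg r ≤ max lo hi ∧ τ.reg b = hi ∧ Inv (τ.reg r) τ)
    (fun τ => ∑ i ∈ Finset.Ico (τ.reg r) hi, (cost i + 1)) ?_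
    ⟨hlo.ge, hlo ▸ le_max_left _ _, hhi, hlo ▸ hI⟩
  · refine hwhile.mono (by rw [hlo]) fun τ _ ⟨⟨hge, hle, hτb, hτI⟩, hge'⟩ => ?_
    rwa [hle.antisymm (max_le hge (hτb ▸ hge'))] at hτI
  · intro τ hfr ⟨hle', _, hτb, hτI⟩ hlt
    have hlt : τ.reg r < hi := hτb ▸ hlt
    refine ⟨_, (hbody _ hle' hlt τ hfr rfl hτI).mono le_rfl fun υ hfr' ⟨hυ, hυI⟩ => ?_⟩
    rw [hυ]
    refine ⟨⟨by omega, hlt.trans_le (le_max_right _ _), (hfr' b hb).trans hτb, hυI⟩, ?_⟩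
    rw [Finset.sum_eq_sum_Ico_succ_bot hlt]

end Runs

/-! ### Instructions in a block -/

namespace TimeImproved

@[simp] theorem val_R (σ : Mem) (r : Reg) : σ.val (R r) = σ.reg r := rfl

@[simp] theorem val_K (σ : Mem) (v : ℕ) : σ.val (K v) = v := rfl

end TimeImproved

/-- The array with entries `f 0, …, f N`. -/
def table (N : ℕ) (f : ℕ → ℕ) : List ℕ := (List.range (N + 1)).map f

section table

variable {N i : ℕ} (f : ℕ → ℕ)

theorem length_table : (table N f).length = N + 1 := by
  rw [table, List.length_map, List.length_range]

theorem table_getElem? (hi : i ≤ N) : (table N f)[i]? = some (f i) := by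
  rw [table, List.getElem?_map, List.getElem?_range (Nat.lt_succ_of_le hi), Option.map_some]

theorem table_set (v : ℕ) : (table N f).set i v = table N (Function.update f i v) := by
  refine List.ext_getElem (by simp only [List.length_set, length_table]) fun j _ _ => ?_
  simp only [table, List.getElem_set, List.getElem_map, List.getElem_range, Function.update_apply,
    eq_comm (a := i)]

/-- Lowering the entry at `i` to `v`, unless it is already smaller: the effect of the
assignments `if v < Compl[i]: Compl[i] := v`. -/
def lower (i v : ℕ) : ℕ → ℕ := Function.update f i (min (f i) v)

end table

namespace Runs

open TimeImproved

variable {l : Limits} {p : Prog} {ps : List Prog} {σ : Mem} {T T' : ℕ} {P Q : Mem → Prop}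
  {x y : Opd} {r r' : Reg}

theorem nil (hQ : Q σ) : Runs l (block []) σ T Q := skip hQ

theorem cons (hp : Runs l p σ T P)
    (hps : ∀ τ, (∀ r ∉ p.targets, τ.reg r = σ.reg r) → P τ → Runs l (block ps) τ T' Q) :
    Runs l (block (p :: ps)) σ (T + T') Q := seq hp hps

theorem cons_instr {i : Instr} {τ : Mem} (h : i.eval σ = some τ) (hτ : σ.Within l → τ.Within l)
    (hps : Runs l (block ps) τ T Q) : Runs l (block (.instr i :: ps)) σ (T + 1) Q := by
  rw [add_comm]
  exact cons (P := (· = τ)) (instr (T := 0) h hτ rfl) fun _ _ hυ => hυ ▸ hps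

theorem move (hv : σ.val x ≤ l.val) (hps : Runs l (block ps) (σ.put r (σ.val x)) T Q) :
    Runs l (block (move r x :: ps)) σ (T + 1) Q :=
  cons_instr rfl (fun hσ => hσ.put r hv) hps

theorem copy (hps : Runs l (block ps) (σ.put r (σ.reg r')) T Q) :
    Runs l (block (TimeImproved.move r (R r') :: ps)) σ (T + 1) Q :=
  of_within fun hσ => move (hσ.reg_le r') hps

theorem add (hv : σ.val x + σ.val y ≤ l.val)
    (hps : Runs l (block ps) (σ.put r (σ.val x + σ.val y)) T Q) :
    Runs l (block (add r x y :: ps)) σ (T + 1) Q :=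
  cons_instr rfl (fun hσ => hσ.put r hv) hps

theorem mul (hv : σ.val x * σ.val y ≤ l.val)
    (hps : Runs l (block ps) (σ.put r (σ.val x * σ.val y)) T Q) :
    Runs l (block (mul r x y :: ps)) σ (T + 1) Q :=
  cons_instr rfl (fun hσ => hσ.put r hv) hps

theorem sub (hle : σ.val y ≤ σ.reg r')
    (hps : Runs l (block ps) (σ.put r (σ.reg r' - σ.val y)) T Q) :
    Runs l (block (sub r (R r') y :: ps)) σ (T + 1) Q :=
  cons_instr (congrArg (Option.map _) (if_pos hle))
    (fun hσ => hσ.put r ((Nat.sub_le _ _).trans (hσ.reg_le r'))) hps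

theorem div (hy : σ.val y ≠ 0) (hps : Runs l (block ps) (σ.put r (σ.reg r' / σ.val y)) T Q) :
    Runs l (block (div r (R r') y :: ps)) σ (T + 1) Q :=
  cons_instr (congrArg (Option.map _) (if_neg hy))
    (fun hσ => hσ.put r ((Nat.div_le_self _ _).trans (hσ.reg_le r'))) hps

theorem push (hlen : σ.arr.length < l.len) (hx : σ.val x ≤ l.cell)
    (hps : Runs l (block ps) ⟨σ.reg, σ.arr ++ [σ.val x]⟩ T Q) :
    Runs l (block (push x :: ps)) σ (T + 1) Q :=
  cons_instr rfl (fun hσ => hσ.append hlen hx) hps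

section table

variable {N : ℕ} {f : ℕ → ℕ}

theorem load (ha : σ.arr = table N f) (hx : σ.val x ≤ N)
    (hps : f (σ.val x) ≤ l.cell → Runs l (block ps) (σ.put r (f (σ.val x))) T Q) :
    Runs l (block (load r x :: ps)) σ (T + 1) Q := by
  have hget : σ.arr[σ.val x]? = some (f (σ.val x)) := ha ▸ table_getElem? f hx
  refine of_within fun hσ => ?_
  have hcell := hσ.mem_le _ (List.mem_of_getElem? hget)
  exact cons_instr (congrArg (Option.map _) hget)
    (fun hσ => hσ.put r (hcell.trans l.cell_le_val)) (hps hcell)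

theorem store (ha : σ.arr = table N f) (hx : σ.val x ≤ N) (hy : σ.val y ≤ l.cell)
    (hQ : Q ⟨σ.reg, table N (Function.update f (σ.val x) (σ.val y))⟩) :
    Runs l (store x y) σ (T + 1) Q := by
  have hset := table_set (N := N) (i := σ.val x) f (σ.val y)
  have hlen : σ.val x < σ.arr.length := by
    rw [ha, length_table]
    exact Nat.lt_succ_of_le hx
  rw [← ha] at hset
  exact instr (if_pos hlen) (fun hσ => hσ.set _ hy) (hset ▸ hQ)

theorem relax {i v w : Reg} (ha : σ.arr = table N f) (hi : σ.reg i ≤ N)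
    (hw : σ.reg w = f (σ.reg i))
    (hps : Runs l (block ps) ⟨σ.reg, table N (lower f (σ.reg i) (σ.reg v))⟩ T Q) :
    Runs l (block (.ifLt (R v) (R w) (TimeImproved.store (R i) (R v)) .skip :: ps)) σ (T + 2)
      Q := by
  rw [add_comm]
  refine cons (P := (· = ⟨σ.reg, table N (lower f (σ.reg i) (σ.reg v))⟩))
    (ifLt (T := 1) (fun h => ?_) fun h => ?_) fun _ _ hυ => hυ ▸ hps
  · simp only [val_R, hw] at h
    refine of_within fun hσ => store (T := 0) ha hi ?_ ?_
    · exact h.le.trans (hσ.mem_le _ (List.mem_of_getElem? (ha ▸ table_getElem? f hi)))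
    · simp only [val_R, lower, min_eq_right h.le]
  · simp only [val_R, hw] at h
    refine skip ?_
    rw [lower, min_eq_left h, Function.update_eq_self, ← ha]

end table

end Runs

/-! ### The subprograms -/

namespace TimeImproved

open Reg

variable {l : Limits} {σ : Mem} {N n : ℕ} {f : ℕ → ℕ}

theorem runs_computeE {out x : Reg} (hx : x ≠ res) (hE : maxVal (σ.reg x) ≤ l.val) :
    Runs l (computeE out x) σ (σ.reg x + 5) fun τ =>
      τ.arr = σ.arr ∧ τ.reg out = maxVal (σ.reg x) := by
  have h1 : 1 ≤ l.val := (maxVal_pos _).trans hE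
  refine Runs.ifLt (T := σ.reg x + 4) (fun h => ?_) fun h => ?_
  · have h0 : σ.reg x = 0 := Nat.lt_one_iff.1 h
    refine Runs.instr rfl (fun hσ => hσ.put out h1) ⟨rfl, ?_⟩
    rw [Mem.put_reg, if_pos rfl, h0]
    rfl
  refine Runs.move h1 (Runs.copy (Runs.of_le (Runs.cons (Runs.whileLt
    (Inv := fun τ => τ.arr = σ.arr ∧ 1 ≤ τ.reg arg ∧
      τ.reg res * maxVal (τ.reg arg) = maxVal (σ.reg x)) (fun τ => τ.reg arg) ?_ ?_)
      (T' := 1) ?_) ?_))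
  · rintro τ - ⟨harr, -, hmul⟩ h4
    simp only [val_K, val_R] at h4
    have hmul' : τ.reg res * 3 * maxVal (τ.reg arg - 3) = maxVal (σ.reg x) := by
      rw [mul_assoc, ← maxVal_eq_three_mul h4, hmul]
    have hres := Nat.le_mul_of_pos_right (τ.reg res * 3) (maxVal_pos (τ.reg arg - 3))
    refine ⟨2, Runs.mul (by simpa using hres.trans (hmul'.trans_le hE))
      (Runs.sub (show 3 ≤ τ.reg arg by omega) (Runs.nil ?_))⟩
    simp only [Mem.put_arr, Mem.put_reg, reduceCtorEq, if_true, if_false, val_K, val_R]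
    exact ⟨⟨harr, by omega, hmul'⟩, by omega⟩
  · simpa [hx] using h
  · rintro τ - ⟨⟨harr, harg, hmul⟩, h4⟩
    rw [maxVal_eq_self harg h4] at hmul
    exact Runs.mul (hmul.trans_le hE) (Runs.nil ⟨harr, by simpa using hmul⟩)
  · simp only [Mem.put_reg, if_true, hx, if_false]
    omega

theorem runs_sumOfE (ht : σ.reg t ≤ σ.reg target) (hE : 2 * maxVal (σ.reg target) ≤ l.val) :
    Runs l sumOfE σ (σ.reg target + 12) fun τ =>
      τ.arr = σ.arr ∧ τ.reg s = maxVal (σ.reg t) + maxVal (σ.reg target - σ.reg t) := by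
  have h₁ : maxVal (σ.reg t) ≤ maxVal (σ.reg target) := maxVal_mono ht
  have h₂ : maxVal (σ.reg target - σ.reg t) ≤ maxVal (σ.reg target) := maxVal_mono (Nat.sub_le _ _)
  refine Runs.of_le (Runs.cons (runs_computeE (by decide) (by omega))
    (T' := σ.reg target - σ.reg t + 7) fun τ hτ ⟨harr, he₁⟩ => ?_) (by omega)
  have hτt := hτ t (by decide)
  have hτT := hτ target (by decide)
  refine Runs.sub (by simpa only [val_R, hτt, hτT]) (Runs.of_le (Runs.cons (runs_computeE
    (by decide) ?_) (T' := 1) fun υ hυ ⟨harr', he₂⟩ => ?_) ?_)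
  all_goals simp only [Mem.put_reg, Mem.put_arr, if_true, val_R, hτt, hτT] at *
  · omega
  · have hυe₁ := hυ e₁ (by decide)
    rw [if_neg (by decide), he₁] at hυe₁
    refine Runs.add ?_ (Runs.nil ⟨?_, ?_⟩) <;> simp only [val_R, hυe₁, he₂]
    · omega
    · exact harr'.trans harr
    · simp
  · omega

theorem runs_cutoffLoop (hn : 2 ≤ σ.reg Reg.n)
    (hT : σ.reg target = intComplexity (σ.reg Reg.n - 1)) (hE : 2 * maxVal (σ.reg target) ≤ l.val)
    (ht : σ.reg t = σ.reg target / 2)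
    (hs : σ.reg s = maxVal (σ.reg t) + maxVal (σ.reg target - σ.reg t)) :
    Runs l (.whileLt (R s) (R Reg.n) (block [sub t (R t) (K 1), sumOfE])) σ
      ((σ.reg target + 14) * σ.reg t + 1) fun τ =>
        τ.arr = σ.arr ∧ IsSumCutoff (σ.reg Reg.n) (τ.reg t) := by
  have hpred := le_maxVal_intComplexity (n := σ.reg Reg.n - 1) (by omega)
  have hwhile := Runs.whileLt (l := l) (σ := σ) (x := R s) (y := R Reg.n)
    (p := block [sub t (R t) (K 1), sumOfE])
    (Inv := fun τ => τ.arr = σ.arr ∧ 2 * τ.reg t ≤ σ.reg target ∧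
      τ.reg s = maxVal (τ.reg t) + maxVal (σ.reg target - τ.reg t) ∧
      ∀ w, τ.reg t < w → 2 * w ≤ σ.reg target →
        maxVal w + maxVal (σ.reg target - w) < σ.reg Reg.n)
    (fun τ => (σ.reg target + 14) * τ.reg t) ?_ ⟨rfl, by omega, hs, fun w _ _ => by omega⟩
  · refine hwhile.mono le_rfl fun τ hτ ⟨⟨harr, h2, hs, hlt⟩, hge⟩ => ⟨harr, ?_, ?_, ?_⟩
    · rwa [← hT]
    · rw [← hT, ← hs, ← hτ Reg.n (by decide)]
      exact hge
    · rwa [← hT]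
  · intro τ hτ ⟨harr, h2, hs, hlt⟩ hsn
    simp only [val_R, hτ Reg.n (by decide)] at hsn
    have hτT := hτ target (by decide)
    have htpos : τ.reg t ≠ 0 := fun h0 => by
      rw [hs, h0, Nat.sub_zero, hT, show maxVal 0 = 1 from rfl] at hsn
      omega
    obtain ⟨w, hw⟩ := Nat.exists_eq_succ_of_ne_zero htpos
    refine ⟨σ.reg target + 12 + 0 + 1, Runs.sub (show 1 ≤ τ.reg t by omega) ?_⟩
    have hsum := runs_sumOfE (l := l) (σ := τ.put t w) (show w ≤ τ.reg target by omega)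
      (by simpa [hτT] using hE)
    simp only [val_K, hw, Nat.succ_sub_one, Mem.put_reg, reduceCtorEq, if_true, if_false, hτT]
      at hsum ⊢
    refine Runs.cons hsum fun υ hυ ⟨harr', hs'⟩ => Runs.nil ?_
    have hυt := hυ t (by decide)
    simp only [Mem.put_reg, if_true] at hυt
    refine ⟨⟨harr'.trans harr, by omega, by rwa [hυt], fun u hu h2u => ?_⟩, ?_⟩
    · rcases (show τ.reg t ≤ u by omega).eq_or_lt with rfl | hu
      · rwa [← hs]
      · exact hlt u hu h2u
    · rw [hυt, Nat.mul_succ]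
      omega

theorem runs_computeKMax (hσn : σ.reg Reg.n = n) (ha : σ.arr = table N f) (hn : 2 ≤ n)
    (hN : n ≤ N) (hf : f (n - 1) = intComplexity (n - 1))
    (hE : 2 * maxVal (intComplexity (n - 1)) ≤ l.val) :
    Runs l computeKMax σ ((intComplexity (n - 1) + 14) * (intComplexity (n - 1) + 2)) fun τ =>
      τ.arr = σ.arr ∧ ∃ t, IsSumCutoff n t ∧ τ.reg kMax = maxVal t := by
  subst hσn
  set c := intComplexity (σ.reg Reg.n - 1)
  have hdiv : c / 2 * 2 ≤ c := Nat.div_mul_le_self c 2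
  refine Runs.of_le (T := c + 12 + ((c + 14) * (c / 2) + 1 + (c / 2 + 5 + 0)) + 3) ?_ (by nlinarith)
  refine Runs.sub (show 1 ≤ σ.reg Reg.n by omega) (Runs.load ha
    (show σ.reg Reg.n - 1 ≤ N by omega) fun _ => Runs.div two_ne_zero ?_)
  simp only [Mem.put_reg, reduceCtorEq, if_true, if_false, val_R, val_K, hf]
  set υ := ((σ.put d (σ.reg Reg.n - 1)).put target c).put t (c / 2)
  have hυn : υ.reg Reg.n = σ.reg Reg.n := by simp [υ]
  have hυT : υ.reg target = c := by simp [υ]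
  have hυt : υ.reg t = c / 2 := by simp [υ]
  have hsum := runs_sumOfE (l := l) (σ := υ) (by omega) (by rwa [hυT])
  rw [hυT, hυt] at hsum
  refine Runs.cons hsum fun τ hτ ⟨harr, hs⟩ => ?_
  have hτn := (hτ Reg.n (by decide)).trans hυn
  have hτT := (hτ target (by decide)).trans hυT
  have hτt := (hτ t (by decide)).trans hυt
  have hloop := runs_cutoffLoop (l := l) (σ := τ) (by omega) (by rw [hτT, hτn]) (by rwa [hτT])
    (by rw [hτt, hτT]) (by rw [hs, hτt, hτT])
  rw [hτT, hτt, hτn] at hloop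
  refine Runs.cons hloop fun φ _ ⟨harr', ht⟩ => ?_
  have htc : φ.reg t ≤ c / 2 := (Nat.le_div_iff_mul_le two_pos).2 (by linarith [ht.two_mul_le])
  have hE' := maxVal_mono (htc.trans (Nat.div_le_self c 2))
  refine Runs.cons ((runs_computeE (by decide) (by omega)).of_le (by omega))
    fun ψ _ ⟨harr'', hk⟩ => Runs.nil ⟨?_, φ.reg t, ht, hk⟩
  rw [harr'', harr', harr]
  rfl

theorem size_div_two_add_one {q : ℕ} (hq : 0 < q) : (q / 2).size + 1 = q.size := by
  obtain ⟨b, h⟩ : ∃ b, Nat.bit b (q / 2) = q := ⟨_, Nat.bit_bodd_div2 q⟩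
  conv_rhs => rw [← h, Nat.size_bit (h.symm ▸ hq.ne')]

theorem runs_binaryDigits (hc : σ.reg cMax = 0) (hq : (σ.reg q).size ≤ l.val) :
    Runs l (.whileLt (K 0) (R q) (block [div q (R q) (K 2), add cMax (R cMax) (K 1)])) σ
      (3 * (σ.reg q).size + 1) fun τ => τ.arr = σ.arr ∧ τ.reg cMax = (σ.reg q).size := by
  have hwhile := Runs.whileLt (l := l) (σ := σ) (x := K 0) (y := R q)
    (p := block [div q (R q) (K 2), add cMax (R cMax) (K 1)])
    (Inv := fun τ => τ.arr = σ.arr ∧ τ.reg cMax + (τ.reg q).size = (σ.reg q).size)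
    (fun τ => 3 * (τ.reg q).size) ?_ ⟨rfl, by omega⟩
  · refine hwhile.mono le_rfl fun τ _ ⟨⟨harr, hτ⟩, h0⟩ => ⟨harr, ?_⟩
    have h0 : τ.reg q = 0 := Nat.le_zero.1 h0
    rwa [h0, Nat.size_zero] at hτ
  · intro τ _ ⟨harr, hτ⟩ h0
    have hsize := size_div_two_add_one h0
    simp only [val_R] at hsize
    refine ⟨2, Runs.div two_ne_zero (Runs.add (show τ.reg cMax + 1 ≤ l.val by omega)
      (Runs.nil ⟨⟨harr, ?_⟩, ?_⟩))⟩ <;>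
      simp only [Mem.put_reg, reduceCtorEq, if_true, if_false, val_R, val_K] <;> omega

theorem runs_pushLoop (hj : σ.reg j = 0) (ha : σ.arr = []) (hl : σ.reg lim = N + 1)
    (hlen : N < l.len) (hval : N < l.val) (hc : σ.reg cMax ≤ l.cell) :
    Runs l (.whileLt (R j) (R lim) (block [push (R cMax), add j (R j) (K 1)])) σ (3 * N + 4)
      fun τ => τ.arr = table N fun _ => σ.reg cMax := by
  have hfor := Runs.forLt (l := l) (σ := σ) (r := j) (b := lim)
    (p := block [push (R cMax), add j (R j) (K 1)])
    (Inv := fun i τ => τ.arr = List.replicate i (σ.reg cMax)) (cost := fun _ => 2) (by decide)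
    (fun i _ hi τ hτ hτj harr => ?_) hj hl ha
  · refine hfor.mono ?_ fun τ _ harr => ?_
    · simp only [Finset.sum_const, Nat.card_Ico, smul_eq_mul]
      omega
    rw [harr, Nat.zero_max, table, List.map_const', List.length_range]
  · have hτc := hτ cMax (by decide)
    refine Runs.push (by rw [harr, List.length_replicate]; omega) (by simpa [hτc])
      (Runs.add (show τ.reg j + 1 ≤ l.val by omega) (Runs.nil ⟨by simp [hτj], ?_⟩))
    simp only [Mem.put_arr, val_R, harr, hτc, List.replicate_succ']

theorem runs_initCompl (hN : 1 ≤ N) (hlen : N < l.len) (hval : (N + 1) ^ 3 ≤ l.val)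
    (hcell : (N ^ 3).size ≤ l.cell) :
    Runs l initCompl (input N) (3 * (N ^ 3).size + 3 * N + 11) fun τ =>
      τ.arr = table N (Function.update (fun _ => (N ^ 3).size) 1 1) ∧ τ.reg lim = N + 1 := by
  have hval₁ : N + 1 ≤ l.val := (Nat.le_self_pow three_ne_zero _).trans hval
  have hval₃ : N ^ 3 ≤ l.val := (Nat.pow_le_pow_left N.le_succ 3).trans hval
  have hval₂ : N ^ 2 ≤ l.val := (Nat.pow_le_pow_right hN (by decide)).trans hval₃
  refine Runs.of_le (T := 3 * (N ^ 3).size + 1 + (3 * N + 6) + 1 + 1 + 1 + 1)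
    ?_ (by omega)
  refine Runs.add (by simpa [input]) (Runs.mul (by simpa [input, ← sq])
    (Runs.mul (by simpa [input, ← pow_succ, ← sq]) (Runs.move (Nat.zero_le _) ?_)))
  have hbits := runs_binaryDigits (l := l) (σ := ((((input N).put lim (N + 1)).put q (N * N)).put q
    (N * N * N)).put cMax 0) (by simp) (by simpa [← pow_succ, ← sq] using hcell.trans l.cell_le_val)
  simp only [Mem.put_reg, reduceCtorEq, if_true, if_false, val_R, val_K, input,
    show N * N * N = N ^ 3 by ring] at hbits ⊢
  refine Runs.cons hbits fun τ hτ ⟨harr, hc⟩ => Runs.move (Nat.zero_le _) ?_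
  have hlim := hτ lim (by decide)
  simp only [Mem.put_reg, reduceCtorEq, if_true, if_false] at hlim
  refine Runs.of_le (Runs.cons (T' := 1) (runs_pushLoop (σ := τ.put j 0) (by simp) (by simp [harr])
    (by simpa) hlen hval₁ (by simpa [hc])) fun υ hυ harr' => ?_) (by omega)
  rw [Mem.put_reg, if_neg (by decide), hc] at harr'
  have hlim' := hυ lim (by decide)
  rw [Mem.put_reg, if_neg (by decide), hlim] at hlim'
  have hsize : 1 ≤ (N ^ 3).size := Nat.size_pos.2 (by positivity)
  have hstore := Runs.store (l := l) (x := K 1) (y := K 1) (T := 0) harr' hN (hsize.trans hcell)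
    (Q := fun τ => τ.arr = table N (Function.update (fun _ => (N ^ 3).size) 1 1) ∧
      τ.reg lim = N + 1) ⟨rfl, hlim'⟩
  exact Runs.cons (T' := 0) hstore fun φ _ hφ => Runs.nil hφ

theorem runs_usualBestValue (hσn : σ.reg Reg.n = n) (ha : σ.arr = table N f) (hn : 1 ≤ n)
    (hN : n ≤ N) (hcell : l.cell < l.val) :
    Runs l usualBestValue σ 6 fun τ => τ.arr = table N (lower f n (f (n - 1) + 1)) := by
  subst hσn
  refine Runs.sub (by simpa) (Runs.load ha (show σ.reg Reg.n - 1 ≤ N by omega) fun hf => Runs.add ?_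
    (Runs.load ha (by simpa) fun _ => Runs.relax (T := 0) ha (by simpa) (by simp)
      (Runs.nil ?_)))
  · simpa using hf.trans_lt hcell
  · simp

/-- The least of `f n` and the sums `f m + f (n - m)` with `6 ≤ m < b`. -/
def minSums (f : ℕ → ℕ) (n b : ℕ) : ℕ :=
  (Finset.Ico 6 b).fold min (f n) fun m => f m + f (n - m)

theorem minSums_six : minSums f n 6 = f n := Finset.fold_empty

theorem minSums_succ {b : ℕ} (hb : 6 ≤ b) :
    minSums f n (b + 1) = min (minSums f n b) (f b + f (n - b)) := by
  rw [minSums, minSums, Nat.Ico_succ_right_eq_insert_Ico hb,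
    Finset.fold_insert Finset.right_notMem_Ico, min_comm]

/-- The body of the loop of `testSums`. -/
def sumTest : Prog :=
  block [
    load a (R m),
    sub d (R Reg.n) (R m),
    load c (R d),
    add a (R a) (R c),
    load c (R Reg.n),
    .ifLt (R a) (R c) (store (R Reg.n) (R a)) .skip,
    add m (R m) (K 1)]

theorem runs_sumTest {i v : ℕ} (ha : σ.arr = table N (Function.update f (σ.reg Reg.n) v))
    (hn : σ.reg Reg.n ≤ N) (hl : N ≤ l.val) (hm : 0 < σ.reg m) (hmn : σ.reg m < σ.reg Reg.n)
    (hi : σ.reg m = i) :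
    Runs l sumTest σ 8 fun τ => τ.reg m = i + 1 ∧
      τ.arr = table N (Function.update f (σ.reg Reg.n) (min v (f i + f (σ.reg Reg.n - i)))) := by
  subst hi
  refine Runs.load ha (show σ.reg m ≤ N by omega) fun h₁ => Runs.sub hmn.le
    (Runs.load ha (show σ.reg Reg.n - σ.reg m ≤ N by omega) fun h₂ =>
      Runs.add ((add_le_add h₁ h₂).trans ((two_mul _).symm.trans_le l.two_mul_cell_le))
        (Runs.load ha hn fun _ => Runs.relax ha hn rfl
          (Runs.add (show σ.reg m + 1 ≤ l.val by omega) (Runs.nil ⟨rfl, ?_⟩))))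
  have h₁ : σ.reg m ≠ σ.reg Reg.n := hmn.ne
  have h₂ : σ.reg Reg.n - σ.reg m ≠ σ.reg Reg.n := by omega
  simp [lower, h₁, h₂]

theorem runs_testSums {b : ℕ} (hσn : σ.reg Reg.n = n) (hσb : σ.reg kMax = b)
    (ha : σ.arr = table N f) (hn : n ≤ N) (hb : b < n) (hl : N ≤ l.val) (h6 : 6 ≤ l.val) :
    Runs l testSums σ (9 * b + 3) fun τ =>
      τ.arr = table N (Function.update f n (minSums f n (b + 1))) := by
  subst hσn hσb
  set υ := (σ.put bound (σ.reg kMax + 1)).put m 6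
  have hfor := Runs.forLt (l := l) (σ := υ) (r := m) (b := bound) (p := sumTest)
    (Inv := fun i τ => τ.arr =
      table N (Function.update f (σ.reg Reg.n) (minSums f (σ.reg Reg.n) i)))
    (cost := fun _ => 8) (lo := 6) (hi := σ.reg kMax + 1) (by decide) ?_ (by simp [υ]) (by simp [υ])
    (by simpa [υ, minSums_six])
  · refine Runs.add (show σ.reg kMax + 1 ≤ l.val by omega) (Runs.move h6 (Runs.of_le
      (Runs.cons (T' := 0) hfor fun τ _ harr => Runs.nil ?_) ?_))
    · rcases le_total 6 (σ.reg kMax + 1) with h | h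
      · rwa [max_eq_right h] at harr
      · rw [max_eq_left h, minSums_six] at harr
        rwa [minSums, Finset.Ico_eq_empty_of_le h]
    · simp only [Finset.sum_const, Nat.card_Ico, smul_eq_mul]
      omega
  · intro i h6i hi τ hτ hτi harr
    have hτn : τ.reg Reg.n = σ.reg Reg.n := by simp [hτ Reg.n (by decide), υ]
    rw [← hτn] at harr
    have hbody := runs_sumTest harr (by omega) hl (by omega) (by omega) hτi
    rwa [hτn, ← minSums_succ h6i] at hbody

/-- Lowering the entries at the multiples `k * n` with `2 ≤ k < b` to `f k + f n`. -/
def lowerProducts (f : ℕ → ℕ) (n b j : ℕ) : ℕ :=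
  if n ∣ j ∧ 2 ≤ j / n ∧ j / n < b then min (f j) (f (j / n) + f n) else f j

theorem lowerProducts_two : lowerProducts f n 2 = f :=
  funext fun _ => if_neg fun h => h.2.1.not_gt h.2.2

theorem lowerProducts_of_div_lt {b j : ℕ} (h : j / n < 2) : lowerProducts f n b j = f j :=
  if_neg fun h' => h'.2.1.not_gt h

theorem lowerProducts_succ {k : ℕ} (hn : 0 < n) (hk : 2 ≤ k) :
    lowerProducts f n (k + 1) = lower (lowerProducts f n k) (k * n) (f k + f n) := by
  funext j
  have hkn : k * n / n = k := Nat.mul_div_cancel k hn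
  rcases eq_or_ne j (k * n) with rfl | hj
  · simp [lower, lowerProducts, hkn, hk]
  · have h : ¬ (n ∣ j ∧ j / n = k) := fun ⟨h, h'⟩ => hj (by rw [← h', Nat.div_mul_cancel h])
    rw [lower, Function.update_of_ne hj, lowerProducts, lowerProducts]
    congr 1
    simp only [eq_iff_iff]
    omega

/-- The body of the loop of `testProducts`. -/
def productTest : Prog :=
  block [
    load a (R k),
    load c (R Reg.n),
    add a (R a) (R c),
    mul idx (R k) (R Reg.n),
    load c (R idx),
    .ifLt (R a) (R c) (store (R idx) (R a)) .skip,
    add k (R k) (K 1)]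

theorem runs_productTest {i : ℕ} (ha : σ.arr = table N (lowerProducts f (σ.reg Reg.n) i))
    (hn : 2 ≤ σ.reg Reg.n) (hk : 2 ≤ σ.reg k) (hkn : σ.reg k ≤ σ.reg Reg.n)
    (hN : σ.reg k * σ.reg Reg.n ≤ N) (hl : N ≤ l.val) (hi : σ.reg k = i) :
    Runs l productTest σ 8 fun τ => τ.reg k = i + 1 ∧
      τ.arr = table N (lowerProducts f (σ.reg Reg.n) (i + 1)) := by
  subst hi
  have hn0 : 0 < σ.reg Reg.n := by omega
  have hfk : lowerProducts f (σ.reg Reg.n) (σ.reg k) (σ.reg k) = f (σ.reg k) :=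
    lowerProducts_of_div_lt ((Nat.div_lt_iff_lt_mul hn0).2 (by omega))
  have hfn : lowerProducts f (σ.reg Reg.n) (σ.reg k) (σ.reg Reg.n) = f (σ.reg Reg.n) :=
    lowerProducts_of_div_lt ((Nat.div_lt_iff_lt_mul hn0).2 (by omega))
  have hk_lt : σ.reg k < σ.reg k * σ.reg Reg.n := lt_mul_of_one_lt_right (by omega) hn
  have hn_le := Nat.le_mul_of_pos_left (σ.reg Reg.n) (show 0 < σ.reg k by omega)
  refine Runs.load ha (show σ.reg k ≤ N by omega) fun h₁ =>
    Runs.load ha (show σ.reg Reg.n ≤ N by omega) fun h₂ =>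
      Runs.add ((add_le_add h₁ h₂).trans ((two_mul _).symm.trans_le l.two_mul_cell_le))
        (Runs.mul (hN.trans hl) (Runs.load ha hN fun _ => Runs.relax ha hN rfl
          (Runs.add (show σ.reg k + 1 ≤ l.val by omega) (Runs.nil ⟨rfl, ?_⟩))))
  simp [lowerProducts_succ hn0 hk, hfk, hfn]

theorem runs_testProducts (hσn : σ.reg Reg.n = n) (hN : σ.reg nMax = N) (ha : σ.arr = table N f)
    (hn : 2 ≤ n) (hnN : n ≤ N) (hl : N < l.val) :
    Runs l testProducts σ (9 * (N / n) + 6) fun τ =>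
      τ.arr = table N (lowerProducts f n (min n (N / n) + 1)) := by
  have hbound : 1 ≤ min n (N / n) :=
    le_min (by omega) ((Nat.one_le_div_iff (by omega)).2 hnN)
  have hnN' : N / n ≤ N := Nat.div_le_self _ _
  refine Runs.of_le (T := 2 + (9 * (N / n) + 1 + 1 + 1) + 1) ?_ (by omega)
  refine Runs.div (show σ.reg Reg.n ≠ 0 by omega) (Runs.cons (P := fun τ => τ.arr = σ.arr ∧
    τ.reg bound = min n (N / n)) ?_ fun τ hτ ⟨harr, hb⟩ => ?_)
  · refine Runs.ifLt (fun h => ?_) fun h => Runs.skip ⟨rfl, ?_⟩ <;>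
      simp only [Mem.put_reg, reduceCtorEq, if_true, if_false, val_R, hN, hσn] at h ⊢
    · refine Runs.instr (T := 0) rfl (fun hσ => hσ.put _ ?_) ⟨rfl, ?_⟩
      · exact show σ.reg Reg.n ≤ l.val by omega
      · simp [h.le, hσn]
    · exact (min_eq_right h).symm
  have hτn : τ.reg Reg.n = n := by simp [hτ Reg.n (by decide), hσn]
  set υ := (τ.put bound (min n (N / n) + 1)).put k 2
  have hfor := Runs.forLt (l := l) (σ := υ) (r := k) (b := bound) (p := productTest)
    (Inv := fun i τ => τ.arr = table N (lowerProducts f n i))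
    (cost := fun _ => 8) (lo := 2) (hi := min n (N / n) + 1)
    (by decide) ?_ (by simp [υ]) (by simp [υ]) (by simpa [υ, lowerProducts_two, harr])
  · refine Runs.add (show τ.reg bound + 1 ≤ l.val by omega)
      (Runs.move (show 2 ≤ l.val by omega) ?_)
    simp only [val_R, hb]
    refine Runs.of_le (Runs.cons (T' := 0) hfor fun φ _ harr' => Runs.nil ?_) ?_
    · rwa [max_eq_right (by omega)] at harr'
    · simp only [Finset.sum_const, Nat.card_Ico, smul_eq_mul]
      omega
  · intro i h2i hi φ hφ hφi harr'
    have hφn : φ.reg Reg.n = n := by simp [hφ Reg.n (by decide), υ, hτn]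
    have hi_le := Nat.lt_succ_iff.1 hi
    have hiN : i * n ≤ N := (Nat.le_div_iff_mul_le (by omega)).1
      (hi_le.trans (min_le_right _ _))
    rw [← hφn] at harr'
    have hbody := runs_productTest (l := l) harr' (by omega) (by omega)
      (by rw [hφi, hφn]; exact hi_le.trans (min_le_left _ _)) (by rwa [hφi, hφn]) hl.le hφi
    rwa [hφn] at hbody

/-! ### Correctness of a round of the main loop -/

/-- The array contents `f` before the round for `n` of the main loop: the values below `n` are
final, and all products of two smaller factors with values below `n` have been tested. -/
structure Invariant (N n : ℕ) (f : ℕ → ℕ) : Prop where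
  eq_of_lt : ∀ j, 1 ≤ j → j < n → f j = intComplexity j
  le_apply : ∀ j, 1 ≤ j → j ≤ N → intComplexity j ≤ f j
  apply_mul_le : ∀ a b, 2 ≤ a → a ≤ b → b < n → a * b ≤ N →
    f (a * b) ≤ intComplexity a + intComplexity b

namespace Invariant

theorem initial (N : ℕ) : Invariant N 2 (Function.update (fun _ => (N ^ 3).size) 1 1) where
  eq_of_lt j h1 h2 := by
    obtain rfl : j = 1 := by omega
    rw [Function.update_self, intComplexity_one]
  le_apply j h1 hj := by
    rcases eq_or_ne j 1 with rfl | h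
    · rw [Function.update_self, intComplexity_one]
    · rw [Function.update_of_ne h]
      exact intComplexity_le_size_pow_three h1 hj
  apply_mul_le a b ha hab hb := by omega

theorem minSums_eq {t : ℕ} (hf : Invariant N n f) (hn : 2 ≤ n) (hN : n ≤ N)
    (ht : IsSumCutoff n t) :
    minSums (lower f n (f (n - 1) + 1)) n (maxVal t + 1) = intComplexity n := by
  have hpred := hf.eq_of_lt (n - 1) (by omega) (by omega)
  have hg : ∀ j, 1 ≤ j → j < n → lower f n (f (n - 1) + 1) j = intComplexity j := fun j h1 hj =>
    (Function.update_of_ne hj.ne _ _).trans (hf.eq_of_lt j h1 hj)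
  have hgn : lower f n (f (n - 1) + 1) n = min (f n) (intComplexity (n - 1) + 1) := by
    rw [lower, Function.update_self, hpred]
  have htn := ht.maxVal_lt hn
  refine le_antisymm (ht.le_intComplexity hn ?_ ?_ ?_) (Finset.le_fold_min _ |>.2 ⟨?_, ?_⟩)
  · exact (Finset.fold_min_le _).2 (.inl (hgn.trans_le (min_le_right _ _)))
  · intro m h6 hm
    refine (Finset.fold_min_le _).2 (.inr ⟨m, by rw [Finset.mem_Ico]; omega, ?_⟩)
    rw [hg m (by omega) (by omega), hg (n - m) (by omega) (by omega)]
  · rintro a b ha hab rfl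
    refine (Finset.fold_min_le _).2 (.inl (hgn.trans_le ((min_le_left _ _).trans ?_)))
    exact hf.apply_mul_le a b ha hab (by nlinarith) hN
  · rw [hgn]
    exact le_min (hf.le_apply n (by omega) hN) (intComplexity_le_pred_add_one hn)
  · intro m hm
    rw [Finset.mem_Ico] at hm
    rw [hg m (by omega) (by omega), hg (n - m) (by omega) (by omega)]
    have := intComplexity_add_le (a := m) (b := n - m) (by omega) (by omega)
    rwa [Nat.add_sub_cancel' (by omega)] at this

theorem update_intComplexity (hf : Invariant N n f) :
    Invariant N n (Function.update f n (intComplexity n)) where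
  eq_of_lt j h1 hj := by rw [Function.update_of_ne hj.ne, hf.eq_of_lt j h1 hj]
  le_apply j h1 hj := by
    rcases eq_or_ne j n with rfl | h
    · rw [Function.update_self]
    · rw [Function.update_of_ne h]
      exact hf.le_apply j h1 hj
  apply_mul_le a b ha hab hb hN := by
    rcases eq_or_ne (a * b) n with h | h
    · rw [h, Function.update_self, ← h]
      exact intComplexity_mul_le (by omega) (by omega)
    · rw [Function.update_of_ne h]
      exact hf.apply_mul_le a b ha hab hb hN

theorem lowerProducts (hf : Invariant N n f) (hn : 2 ≤ n) (hfn : f n = intComplexity n) :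
    Invariant N (n + 1) (lowerProducts f n (min n (N / n) + 1)) := by
  have hfinal : ∀ j, 1 ≤ j → j < n + 1 → f j = intComplexity j := fun j h1 hj =>
    (Nat.le_of_lt_succ hj).eq_or_lt.elim (fun h => h ▸ hfn) (hf.eq_of_lt j h1)
  refine ⟨fun j h1 hj => ?_, fun j h1 hj => ?_, fun a b ha hab hb hN => ?_⟩
  · rw [lowerProducts_of_div_lt ((Nat.div_lt_iff_lt_mul (by omega)).2 (by omega)), hfinal j h1 hj]
  · rw [TimeImproved.lowerProducts]
    split_ifs with h
    · obtain ⟨⟨k, rfl⟩, h2, hk⟩ := h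
      rw [Nat.mul_div_cancel_left k (by omega)] at *
      rw [hfinal k (by omega) (by omega), hfn, mul_comm]
      refine le_min ?_ (intComplexity_mul_le (by omega) (by omega))
      exact mul_comm n k ▸ hf.le_apply _ h1 hj
    · exact hf.le_apply j h1 hj
  · rcases (Nat.le_of_lt_succ hb).eq_or_lt with rfl | h
    · have hdiv : a * b / b = a := Nat.mul_div_cancel a (by omega)
      have haN : a ≤ N / b := (Nat.le_div_iff_mul_le (by omega)).2 hN
      rw [TimeImproved.lowerProducts, hdiv, if_pos ⟨Nat.dvd_mul_left b a, ha, by omega⟩,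
        hfinal a (by omega) (by omega), hfn]
      exact min_le_right _ _
    · refine le_trans ?_ (hf.apply_mul_le a b ha hab h hN)
      rw [TimeImproved.lowerProducts]
      split_ifs
      exacts [min_le_left _ _, le_rfl]

end Invariant

/-! ### The whole program -/

/-- The limits obeyed by the algorithm with input `N`. -/
def limits (N : ℕ) : Limits where
  val := 2 * (N + 1) ^ 3
  len := N + 1
  cell := (N ^ 3).size
  two_mul_cell_le := Nat.mul_le_mul_left 2
    ((Nat.size_le_size (Nat.pow_le_pow_left N.le_succ 3)).trans
      (Nat.size_le.2 (Nat.lt_two_pow_self)))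

/-- A bound for the number of steps in the round for `n` of the main loop. -/
noncomputable def roundCost (N n : ℕ) : ℕ :=
  (intComplexity (n - 1) + 14) * (intComplexity (n - 1) + 2) +
    9 * (2 * maxVal (intComplexity (n - 1)) / n) + 9 * (N / n) + 16

/-- A bound for the number of steps of the program with input `N`. -/
noncomputable def programCost (N : ℕ) : ℕ :=
  3 * (N ^ 3).size + 3 * N + 13 + ∑ n ∈ Finset.Ico 2 (N + 1), (roundCost N n + 1)

theorem cell_lt_val : (limits N).cell < (limits N).val := by
  have hcell := (limits N).two_mul_cell_le
  have hval : 0 < (limits N).val := Nat.mul_pos two_pos (by positivity)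
  omega

theorem runs_round (hσn : σ.reg Reg.n = n) (hσN : σ.reg nMax = N) (ha : σ.arr = table N f)
    (hf : Invariant N n f) (hn : 2 ≤ n) (hN : n ≤ N) :
    Runs (limits N) (block [usualBestValue, computeKMax, testSums, testProducts,
      add Reg.n (R Reg.n) (K 1)]) σ (roundCost N n) fun τ =>
        τ.reg Reg.n = n + 1 ∧ ∃ g, τ.arr = table N g ∧ Invariant N (n + 1) g := by
  have hcube : 3 ^ 2 * (N + 1) ≤ (N + 1) ^ 3 :=
    Nat.mul_le_mul_right (N + 1) (Nat.pow_le_pow_left (by omega) 2)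
  have hval : (limits N).val = 2 * (N + 1) ^ 3 := rfl
  have hpred := hf.eq_of_lt (n - 1) (by omega) (by omega)
  have hE : maxVal (intComplexity (n - 1)) ≤ (N + 1) ^ 3 :=
    (maxVal_intComplexity_le_sq (by omega)).trans
      ((Nat.pow_le_pow_left (by omega) 2).trans (Nat.pow_le_pow_right N.succ_pos (by decide)))
  refine Runs.of_le (Runs.cons (T' := (intComplexity (n - 1) + 14) * (intComplexity (n - 1) + 2) +
    (9 * (2 * maxVal (intComplexity (n - 1)) / n) + 9 * (N / n) + 10))
    (runs_usualBestValue hσn ha (by omega) hN cell_lt_val) fun τ hτ harr => ?_)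
    (by rw [roundCost]; omega)
  have hτn := (hτ Reg.n (by decide)).trans hσn
  have hgpred : lower f n (f (n - 1) + 1) (n - 1) = intComplexity (n - 1) :=
    (Function.update_of_ne (by omega) _ _).trans hpred
  refine Runs.cons (runs_computeKMax hτn harr hn hN hgpred (by omega))
    fun υ hυ ⟨harr', _, ht, hk⟩ => ?_
  have hυn := (hυ Reg.n (by decide)).trans hτn
  have hυN := (hυ nMax (by decide)).trans ((hτ nMax (by decide)).trans hσN)
  have hkdiv := ht.maxVal_le_div (by omega)
  refine Runs.of_le (Runs.cons (T' := 9 * (N / n) + 6 + 1) (runs_testSums hυn hk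
    (harr'.trans harr) hN (ht.maxVal_lt hn) (by omega) (by omega)) fun φ hφ harr'' => ?_) (by omega)
  rw [hf.minSums_eq hn hN ht, lower, Function.update_idem] at harr''
  have hφn := (hφ Reg.n (by decide)).trans hυn
  refine Runs.cons (runs_testProducts (l := limits N) hφn ((hφ nMax (by decide)).trans hυN) harr''
    hn hN (by omega)) fun ψ hψ harr => ?_
  have hψn := (hψ Reg.n (by decide)).trans hφn
  have hinv := hf.update_intComplexity.lowerProducts hn (Function.update_self ..)
  exact Runs.add (T := 0) (show ψ.reg Reg.n + 1 ≤ (limits N).val by omega)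
    (Runs.nil ⟨by simp [hψn], _, harr, hinv⟩)

theorem runs_program (hN : 1 ≤ N) :
    Runs (limits N) program (input N) (programCost N) fun τ =>
      ∀ n, 1 ≤ n → n ≤ N → τ.arr[n]? = some (intComplexity n) := by
  have hcube : N + 1 ≤ (N + 1) ^ 3 := Nat.le_self_pow three_ne_zero _
  have hval : (limits N).val = 2 * (N + 1) ^ 3 := rfl
  refine Runs.of_le (Runs.cons (T' := ∑ n ∈ Finset.Ico 2 (N + 1), (roundCost N n + 1) + 2)
    (runs_initCompl hN N.lt_succ_self (by omega) le_rfl) fun τ hτ ⟨harr, hlim⟩ =>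
      Runs.move (show 2 ≤ (limits N).val by omega) ?_) (by rw [programCost]; omega)
  have hfor := Runs.forLt (l := limits N) (σ := τ.put Reg.n 2) (r := Reg.n) (b := lim)
    (p := block [usualBestValue, computeKMax, testSums, testProducts, add Reg.n (R Reg.n) (K 1)])
    (Inv := fun i τ => ∃ f, τ.arr = table N f ∧ Invariant N i f)
    (cost := roundCost N) (lo := 2) (hi := N + 1) (by decide) ?_ (by simp) (by simp [hlim])
    ⟨_, harr, .initial N⟩
  · refine Runs.cons (T' := 0) hfor fun υ _ ⟨f, harr, hf⟩ => Runs.nil fun n h1 hn => ?_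
    rw [harr, table_getElem? f hn, hf.eq_of_lt n h1 (by omega)]
  · intro n h2 hn υ hυ hυn ⟨f, harr, hf⟩
    refine runs_round hυn ?_ harr hf h2 (by omega)
    rw [hυ nMax (by decide), Mem.put_reg, if_neg (by decide), hτ nMax (by decide)]
    rfl

end TimeImproved

/-! ### The mean size of `3 ^ (‖n‖ / 3) / n` -/

/-- The weight `3 ^ (‖n‖ / 3) / n`, which bounds the number of summands to be tested after `n`. The
junk value at `0` is `0`. -/
noncomputable def complexityWeight (n : ℕ) : ℝ :=
  (3 : ℝ) ^ ((intComplexity n : ℝ) / 3) / n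

theorem complexityWeight_nonneg (n : ℕ) : 0 ≤ complexityWeight n := by
  unfold complexityWeight; positivity

theorem maxVal_le_rpow (k : ℕ) : (maxVal k : ℝ) ≤ (3 : ℝ) ^ ((k : ℝ) / 3) := by
  refine le_of_pow_le_pow_left₀ three_ne_zero (by positivity) ?_
  rw [← Real.rpow_mul_natCast (by norm_num), Nat.cast_ofNat, div_mul_cancel₀ _ (by norm_num),
    Real.rpow_natCast]
  exact_mod_cast maxVal_pow_three_le k

theorem complexityWeight_le_div {p n : ℕ} (hp : 1 ≤ p) (hn : p ≤ n) :
    complexityWeight n ≤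
      (3 : ℝ) ^ (((p + n % p : ℕ) : ℝ) / 3) / p * complexityWeight (n / p) := by
  have hq : (0 : ℝ) < (n / p : ℕ) := by exact_mod_cast Nat.div_pos hn hp
  have : (0 : ℝ) < p := by exact_mod_cast hp
  have hle : (p : ℝ) * (n / p : ℕ) ≤ n := by exact_mod_cast Nat.mul_div_le n p
  have hc : (intComplexity n : ℝ) ≤ intComplexity (n / p) + (p + n % p : ℕ) := by
    exact_mod_cast intComplexity_le_div_add hp hn
  calc complexityWeight n
      ≤ (3 : ℝ) ^ (((p + n % p : ℕ) : ℝ) / 3 + (intComplexity (n / p) : ℝ) / 3) /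
          (p * (n / p : ℕ)) := by
        unfold complexityWeight
        gcongr
        · norm_num
        · linarith
    _ = _ := by
        rw [Real.rpow_add (by norm_num), mul_div_mul_comm, complexityWeight]

/-- The sum of the weights of the integers `1, …, N` that leave the remainder `r` modulo `b`. -/
noncomputable def classSum (b r N : ℕ) : ℝ :=
  ∑ n ∈ Finset.Icc 1 N with n % b = r, complexityWeight n

/-- The sum of the weights of the integers `1, …, N`. -/
noncomputable def weightSum (N : ℕ) : ℝ := ∑ n ∈ Finset.Icc 1 N, complexityWeight n

theorem weightSum_nonneg (N : ℕ) : 0 ≤ weightSum N :=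
  Finset.sum_nonneg fun n _ => complexityWeight_nonneg n

theorem sum_classSum {b : ℕ} (hb : 0 < b) (N : ℕ) :
    ∑ r ∈ Finset.range b, classSum b r N = weightSum N :=
  Finset.sum_fiberwise_of_maps_to (fun n _ => Finset.mem_range.2 (Nat.mod_lt n hb)) _

theorem classSum_eq_sum {b s p : ℕ} (hp : 0 < p) (hs : s < b) (N : ℕ) :
    classSum b s N = ∑ k ∈ Finset.range p, classSum (b * p) (s + b * k) N := by
  rw [classSum, ← Finset.sum_fiberwise_of_maps_to (g := fun n => n / b % p) (t := Finset.range p)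
    fun n _ => Finset.mem_range.2 (Nat.mod_lt _ hp)]
  refine Finset.sum_congr rfl fun k _ => ?_
  rw [classSum, Finset.filter_filter]
  congr 1
  refine Finset.filter_congr fun n _ => ⟨fun ⟨hmod, hdiv⟩ => ?_, fun h => ?_⟩
  · rw [Nat.mod_mul, hmod, hdiv]
  · rw [← Nat.mod_mul_right_mod n b p, ← Nat.mod_mul_right_div_self, h, Nat.add_mul_mod_self_left,
      Nat.add_mul_div_left _ _ (by omega), Nat.mod_eq_of_lt hs, Nat.div_eq_of_lt hs, zero_add]
    exact ⟨rfl, rfl⟩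

theorem classSum_le_div {p : ℕ} (hp : 1 ≤ p) (b r N : ℕ) :
    classSum (p * b) r N ≤ weightSum p +
      (3 : ℝ) ^ (((p + r % p : ℕ) : ℝ) / 3) / p * classSum b (r / p) (N / p) := by
  have hmod {n : ℕ} (h : n % (p * b) = r) : n % p = r % p := by rw [← h, Nat.mod_mul_right_mod]
  have hdiv {n : ℕ} (h : n % (p * b) = r) : n / p % b = r / p := by
    rw [← h, Nat.mod_mul_right_div_self]
  rw [classSum, ← Finset.sum_filter_add_sum_filter_not _ (· < p), Finset.filter_filter,
    Finset.filter_filter]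
  gcongr ?_ + ?_
  · refine Finset.sum_le_sum_of_subset_of_nonneg (fun n hn => ?_) fun n _ _ =>
      complexityWeight_nonneg n
    simp only [Finset.mem_filter, Finset.mem_Icc] at hn ⊢
    omega
  · refine (Finset.sum_le_sum (g := fun n => (3 : ℝ) ^ (((p + r % p : ℕ) : ℝ) / 3) / p *
      complexityWeight (n / p)) fun n hn => ?_).trans ?_
    · obtain ⟨-, hr, hpn⟩ := Finset.mem_filter.1 hn
      rw [← hmod hr]
      exact complexityWeight_le_div hp (not_lt.1 hpn)
    · rw [← Finset.mul_sum, ← Finset.sum_image (g := (· / p)) (f := complexityWeight)]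
      · refine mul_le_mul_of_nonneg_left (Finset.sum_le_sum_of_subset_of_nonneg (fun q hq => ?_)
          fun n _ _ => complexityWeight_nonneg n) (by positivity)
        obtain ⟨n, hn, rfl⟩ := Finset.mem_image.1 hq
        obtain ⟨hnN, hr, hpn⟩ := Finset.mem_filter.1 hn
        exact Finset.mem_filter.2 ⟨Finset.mem_Icc.2 ⟨Nat.div_pos (not_lt.1 hpn) hp,
          Nat.div_le_div_right (Finset.mem_Icc.1 hnN).2⟩, hdiv hr⟩
      · intro n hn m hm (hnm : n / p = m / p)
        rw [← Nat.div_add_mod n p, ← Nat.div_add_mod m p, hnm, hmod (Finset.mem_filter.1 hn).2.1,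
          hmod (Finset.mem_filter.1 hm).2.1]

/-- The factor by which a division by `p` with remainder `d` changes a bound `C * N ^ α` for a sum
of weights. -/
noncomputable def stepWeight (α : ℝ) (p d : ℕ) : ℝ :=
  (3 : ℝ) ^ (((p + d : ℕ) : ℝ) / 3) * (p : ℝ) ^ (-(1 + α))

/-- A positive function on the residues modulo `b` which strictly decreases when the members of a
class are divided by a suitable divisor `p` of `b`: the quotients of the class of `r` fill the `p`
classes `r / p + b / p * k` with `k < p`. -/
def IsSupersolution (α : ℝ) (b : ℕ) (v : ℕ → ℝ) : Prop :=
  ∀ r < b, 0 < v r ∧ ∃ p, 2 ≤ p ∧ p ∣ b ∧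
    stepWeight α p (r % p) * ∑ k ∈ Finset.range p, v (r / p + b / p * k) < v r

theorem classSum_le_of_forall_div {α : ℝ} (hα : 0 ≤ α) {b p r N : ℕ} (hp : 2 ≤ p) (hpb : p ∣ b)
    (hr : r < b) {v : ℕ → ℝ} {C : ℝ} (hC : 0 ≤ C) (hv : ∀ s < b, 0 ≤ v s)
    (h : ∀ s < b, classSum b s (N / p) ≤ C * (v s * ((N / p : ℕ) : ℝ) ^ α)) :
    classSum b r N ≤ weightSum p + C *
      (stepWeight α p (r % p) * (∑ k ∈ Finset.range p, v (r / p + b / p * k)) * (N : ℝ) ^ α) := by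
  obtain ⟨c, rfl⟩ := hpb
  have hp0 : (0 : ℝ) < p := by exact_mod_cast (by omega : 0 < p)
  have hs : r / p < c := Nat.div_lt_of_lt_mul hr
  have hlt : ∀ k ∈ Finset.range p, r / p + c * k < p * c := fun k hk => by
    have := Nat.mul_le_mul_left c (Finset.mem_range.1 hk)
    rw [Nat.mul_succ] at this
    rw [mul_comm p c]
    omega
  have hquot : ((N / p : ℕ) : ℝ) ^ α ≤ (N : ℝ) ^ α / (p : ℝ) ^ α := by
    rw [← Real.div_rpow (by positivity) hp0.le]
    exact Real.rpow_le_rpow (by positivity) Nat.cast_div_le hα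
  have hstep : stepWeight α p (r % p) =
      (3 : ℝ) ^ (((p + r % p : ℕ) : ℝ) / 3) / p / (p : ℝ) ^ α := by
    rw [stepWeight, Real.rpow_neg hp0.le, Real.rpow_add hp0, Real.rpow_one,
      ← div_eq_mul_inv, div_div]
  have hV : 0 ≤ ∑ k ∈ Finset.range p, v (r / p + c * k) :=
    Finset.sum_nonneg fun k hk => hv _ (hlt k hk)
  rw [Nat.mul_div_cancel_left c (by omega)]
  refine (classSum_le_div (by omega) c r N).trans (add_le_add_right ?_ _)
  calc _ ≤ (3 : ℝ) ^ (((p + r % p : ℕ) : ℝ) / 3) / p *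
          (C * ((∑ k ∈ Finset.range p, v (r / p + c * k)) * ((N / p : ℕ) : ℝ) ^ α)) := by
        rw [classSum_eq_sum (p := p) (by omega) hs, mul_comm c p, Finset.sum_mul,
          Finset.mul_sum _ _ C]
        gcongr with k hk
        exact h _ (hlt k hk)
    _ ≤ (3 : ℝ) ^ (((p + r % p : ℕ) : ℝ) / 3) / p *
          (C * ((∑ k ∈ Finset.range p, v (r / p + c * k)) * ((N : ℝ) ^ α / (p : ℝ) ^ α))) := by
        gcongr
    _ = _ := by rw [hstep]; ring

theorem IsSupersolution.exists_classSum_le {α : ℝ} (hα : 0 ≤ α) {b : ℕ} {v : ℕ → ℝ}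
    (h : IsSupersolution α b v) :
    ∃ C, 0 ≤ C ∧ ∀ N, ∀ r < b, classSum b r N ≤ C * (v r * (N : ℝ) ^ α) := by
  choose! hv p hp hpb hlt using h
  set T := fun r =>
    stepWeight α (p r) (r % p r) * ∑ k ∈ Finset.range (p r), v (r / p r + b / p r * k)
  have hgap : ∀ r < b, 0 < v r - T r := fun r hr => sub_pos.2 (hlt r hr)
  have hterm : ∀ r ∈ Finset.range b, 0 ≤ weightSum (p r) / (v r - T r) := fun r hr =>
    div_nonneg (weightSum_nonneg _) (hgap r (Finset.mem_range.1 hr)).le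
  set C := ∑ r ∈ Finset.range b, weightSum (p r) / (v r - T r)
  have hC : 0 ≤ C := Finset.sum_nonneg hterm
  have hCr : ∀ r < b, weightSum (p r) ≤ C * (v r - T r) := fun r hr =>
    (div_le_iff₀ (hgap r hr)).1 (Finset.single_le_sum hterm (Finset.mem_range.2 hr))
  refine ⟨C, hC, fun N => ?_⟩
  induction N using Nat.strong_induction_on with | _ N ih => ?_
  intro r hr
  rcases N.eq_zero_or_pos with rfl | hN
  · simpa [classSum] using mul_nonneg hC (mul_nonneg (hv r hr).le (Real.rpow_nonneg le_rfl α))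
  calc classSum b r N ≤ weightSum (p r) + C * (T r * (N : ℝ) ^ α) :=
        classSum_le_of_forall_div hα (hp r hr) (hpb r hr) hr hC (fun s hs => (hv s hs).le)
          (ih _ (Nat.div_lt_self hN (hp r hr)))
    _ ≤ C * (v r - T r) * (N : ℝ) ^ α + C * (T r * (N : ℝ) ^ α) := by
        have hone : 1 ≤ (N : ℝ) ^ α := Real.one_le_rpow (by exact_mod_cast hN) hα
        gcongr
        exact (hCr r hr).trans
          (le_mul_of_one_le_right (mul_nonneg hC (hgap r hr).le) hone)
    _ = C * (v r * (N : ℝ) ^ α) := by ring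

theorem stepWeight_le_of_pow_le {p d c : ℕ} (hp : 1 ≤ p)
    (h : 3 ^ (100 * (p + d)) * (10 ^ 4) ^ 300 ≤ c ^ 300 * p ^ 669) :
    stepWeight 1.23 p d ≤ c / 10 ^ 4 := by
  have hp0 : (0 : ℝ) < p := by exact_mod_cast hp
  have h3 : ((3 : ℝ) ^ (((p + d : ℕ) : ℝ) / 3)) ^ 300 = 3 ^ (100 * (p + d)) := by
    rw [← Real.rpow_mul_natCast (by norm_num), ← Real.rpow_natCast]
    congr 1
    push_cast
    ring
  have hpow : ((p : ℝ) ^ (-(1 + 1.23) : ℝ)) ^ 300 = ((p : ℝ) ^ 669)⁻¹ := by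
    rw [← Real.rpow_mul_natCast hp0.le, ← Real.rpow_natCast, ← Real.rpow_neg hp0.le]
    norm_num
  refine le_of_pow_le_pow_left₀ (n := 300) (by norm_num) (by positivity) ?_
  rw [stepWeight, mul_pow, h3, hpow, div_pow, le_div_iff₀ (by positivity), mul_right_comm,
    ← div_eq_mul_inv, div_le_iff₀ (by positivity)]
  exact_mod_cast h

/-- The values of a supersolution modulo `18` for the exponent `1.23`, rounded to integers. They
were found by iterating `v r ↦ min p, stepWeight 1.23 p (r % p) * ∑ k, v (r / p + 18 / p * k)`
over `p ∈ {2, 3}` and rescaling. -/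
def potential (r : ℕ) : ℕ :=
  [78, 113, 114, 113, 143, 206, 103, 149, 140, 100, 144, 208, 120, 172, 143, 172, 173, 250].getD r 0

/-- Upper bounds for `10 ^ 4 * stepWeight 1.23 p d`, where `p` is `2` or `3` and `d < p`. -/
def stepBound (p d : ℕ) : ℕ :=
  if p = 2 then [4434, 6395].getD d 0 else [2590, 3735, 5386].getD d 0

theorem stepWeight_le_stepBound {p d : ℕ} (hp : p = 2 ∨ p = 3) (hd : d < p) :
    stepWeight 1.23 p d ≤ stepBound p d / 10 ^ 4 := by
  refine stepWeight_le_of_pow_le (by omega) ?_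
  rcases hp with rfl | rfl <;> interval_cases d <;> decide +kernel

theorem isSupersolution_potential : IsSupersolution 1.23 18 fun r => potential r := by
  have hcheck : ∀ r < 18, 0 < potential r ∧ ∃ p ∈ ({2, 3} : Finset ℕ),
      stepBound p (r % p) * ∑ k ∈ Finset.range p, potential (r / p + 18 / p * k) <
        10 ^ 4 * potential r := by
    decide
  intro r hr
  obtain ⟨hpos, p, hp, hlt⟩ := hcheck r hr
  have hp : p = 2 ∨ p = 3 := by simpa using hp
  have hlt' : stepBound p (r % p) * ∑ k ∈ Finset.range p, (potential (r / p + 18 / p * k) : ℝ) <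
      10 ^ 4 * potential r := by exact_mod_cast hlt
  refine ⟨Nat.cast_pos.2 hpos, p, by omega, by rcases hp with rfl | rfl <;> norm_num, ?_⟩
  calc _ ≤ (stepBound p (r % p) / 10 ^ 4 : ℝ) *
          ∑ k ∈ Finset.range p, (potential (r / p + 18 / p * k) : ℝ) := by
        gcongr
        exact stepWeight_le_stepBound hp (Nat.mod_lt _ (by omega))
    _ < potential r := by linarith

theorem exists_weightSum_le : ∃ C : ℝ, 0 ≤ C ∧ ∀ N, weightSum N ≤ C * (N : ℝ) ^ (1.23 : ℝ) := by
  obtain ⟨C, hC, h⟩ := isSupersolution_potential.exists_classSum_le (by norm_num)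
  refine ⟨C * ∑ r ∈ Finset.range 18, (potential r : ℝ), by positivity, fun N => ?_⟩
  rw [← sum_classSum (b := 18) (by norm_num), mul_assoc, Finset.sum_mul, Finset.mul_sum]
  exact Finset.sum_le_sum fun r hr => h N r (Finset.mem_range.1 hr)

/-! ### Growth of the bounds -/

open Filter Asymptotics

theorem bitLen_le_log {v : ℕ} (hv : 1 ≤ v) : (bitLen v : ℝ) ≤ 1 + 3 / 2 * Real.log v := by
  obtain ⟨s, hs⟩ : ∃ s, v.size = s + 1 := Nat.exists_eq_add_one.2 (Nat.size_pos.2 hv)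
  have hpow : (2 : ℝ) ^ s ≤ v := by exact_mod_cast Nat.lt_size.1 (by omega)
  have hlog : s * Real.log 2 ≤ Real.log v := by
    rw [← Real.log_pow]
    exact Real.log_le_log (by positivity) hpow
  have hbit : bitLen v = s + 1 := (max_eq_right (Nat.size_pos.2 hv)).trans hs
  have htwo : (s : ℝ) * 0.69 ≤ s * Real.log 2 := by
    gcongr
    linarith [Real.log_two_gt_d9]
  rw [hbit]
  push_cast
  linarith

theorem isBigO_mul_one_add_log_sq {β : ℝ} (hβ : 1 < β) :
    (fun x : ℝ => x * (1 + Real.log x) ^ 2) =O[atTop] fun x => x ^ β := by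
  have hpos : 0 < (β - 1) / 2 := by linarith
  have hone : (fun _ : ℝ => (1 : ℝ)) =O[atTop] fun x => x ^ ((β - 1) / 2) :=
    ((isLittleO_const_left.2 <| .inr <|
      tendsto_norm_atTop_atTop.comp (tendsto_rpow_atTop hpos))).isBigO
  have hlog := (hone.add (isLittleO_log_rpow_atTop hpos).isBigO).pow 2
  refine ((isBigO_refl (fun x : ℝ => x) atTop).mul hlog).congr' .rfl ?_
  filter_upwards [eventually_gt_atTop 0] with x hx
  rw [← Real.rpow_mul_natCast hx.le, ← Real.rpow_one_add' hx.le (by norm_num; linarith)]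
  congr 1
  push_cast
  ring

theorem isBigO_natCast_of_eventually_le {α : Type*} {l : Filter α} {u v : α → ℕ} {g : α → ℝ}
    (huv : ∀ᶠ x in l, u x ≤ v x) (hv : (fun x => (v x : ℝ)) =O[l] g) :
    (fun x => (u x : ℝ)) =O[l] g := by
  refine .trans (.of_norm_eventuallyLE ?_) hv
  filter_upwards [huv] with x hx
  rw [Real.norm_natCast]
  exact_mod_cast hx

namespace TimeImproved

theorem cell_pos {N : ℕ} (hN : 1 ≤ N) : 1 ≤ (limits N).cell :=
  Nat.size_pos.2 (by positivity)

theorem cell_le_log {N : ℕ} (hN : 1 ≤ N) : ((limits N).cell : ℝ) ≤ 5 * (1 + Real.log N) := by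
  have hbit := bitLen_le_log (v := N ^ 3) (Nat.one_le_pow _ _ hN)
  have hcell : ((limits N).cell : ℝ) ≤ bitLen (N ^ 3) := by exact_mod_cast le_max_right _ _
  rw [Nat.cast_pow, Real.log_pow, Nat.cast_ofNat] at hbit
  linarith [Real.log_natCast_nonneg N]

theorem one_le_log {N : ℕ} (hN : 3 ≤ N) : 1 ≤ Real.log N := by
  have hN' : (3 : ℝ) ≤ N := by exact_mod_cast hN
  rw [Real.le_log_iff_exp_le (by linarith)]
  linarith [Real.exp_one_lt_d9]

theorem width_le_log {N : ℕ} (hN : 3 ≤ N) : ((limits N).width : ℝ) ≤ 12 * Real.log N := by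
  have hval : (limits N).val ≤ N ^ 7 := by
    calc (limits N).val = 2 * (N + 1) ^ 3 := rfl
      _ ≤ 2 * (2 * N) ^ 3 := by gcongr; omega
      _ = 16 * N ^ 3 := by ring
      _ ≤ 3 ^ 4 * N ^ 3 := by gcongr; norm_num
      _ ≤ N ^ 4 * N ^ 3 := by gcongr
      _ = N ^ 7 := by ring
  have hbit := bitLen_le_log (v := N ^ 7) (Nat.one_le_pow _ _ (by omega))
  have hwidth : ((limits N).width : ℝ) ≤ bitLen (N ^ 7) := by exact_mod_cast bitLen_mono hval
  rw [Nat.cast_pow, Real.log_pow, Nat.cast_ofNat] at hbit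
  linarith [one_le_log hN]

theorem bitLen_cell_le_log_log {N : ℕ} (hN : 3 ≤ N) (hlog : 1 ≤ Real.log (Real.log N)) :
    (bitLen (limits N).cell : ℝ) ≤ 16 * Real.log (Real.log N) := by
  have hlogN := one_le_log hN
  have hpos : (0 : ℝ) < (limits N).cell := by exact_mod_cast cell_pos (by omega)
  have hcell : Real.log (limits N).cell ≤ Real.log (10 * Real.log N) :=
    Real.log_le_log hpos (by linarith [cell_le_log (show 1 ≤ N by omega)])
  rw [Real.log_mul (by norm_num) (by linarith)] at hcell
  have hten : Real.log 10 ≤ 10 - 1 := Real.log_le_sub_one_of_pos (by norm_num)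
  linarith [bitLen_le_log (cell_pos (show 1 ≤ N by omega))]

theorem isBigO_width :
    (fun N : ℕ => ((limits N).width : ℝ)) =O[atTop] fun N : ℕ => Real.log (N : ℝ) := by
  refine .of_bound 12 ?_
  filter_upwards [eventually_ge_atTop 3] with N hN
  rw [Real.norm_natCast, Real.norm_of_nonneg (Real.log_natCast_nonneg N)]
  exact width_le_log hN

theorem isBigO_space :
    (fun N : ℕ => ((limits N).space : ℝ))
      =O[atTop] fun N : ℕ => (N : ℝ) * Real.log (Real.log (N : ℝ)) := by
  have hloglog : Tendsto (fun N : ℕ => Real.log (Real.log (N : ℝ))) atTop atTop :=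
    Real.tendsto_log_atTop.comp (Real.tendsto_log_atTop.comp tendsto_natCast_atTop_atTop)
  refine .of_bound 300 ?_
  filter_upwards [eventually_ge_atTop 3, hloglog.eventually_ge_atTop 1] with N hN hlog
  have hN1 : (1 : ℝ) ≤ N := by exact_mod_cast (by omega : 1 ≤ N)
  have hwidth : ((limits N).width : ℝ) ≤ 12 * (N * Real.log (Real.log N)) := by
    refine (width_le_log hN).trans (mul_le_mul_of_nonneg_left ?_ (by norm_num))
    exact (Real.log_le_self (by positivity)).trans (le_mul_of_one_le_right (by positivity) hlog)
  have hcells : ((N + 1 : ℕ) : ℝ) * bitLen (limits N).cell ≤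
      (2 * N) * (16 * Real.log (Real.log N)) := by
    gcongr
    · push_cast
      linarith
    · exact bitLen_cell_le_log_log hN hlog
  have hspace : (limits N).space = 22 * (limits N).width + (N + 1) * bitLen (limits N).cell := rfl
  have hpos : 0 ≤ N * Real.log (Real.log N) := by positivity
  rw [Real.norm_natCast, Real.norm_of_nonneg hpos, hspace, Nat.cast_add, Nat.cast_mul, Nat.cast_mul,
    Nat.cast_ofNat]
  linarith

theorem intComplexity_pred_le_log {N n : ℕ} (hn : 2 ≤ n) (hN : n ≤ N) :
    (intComplexity (n - 1) : ℝ) ≤ 5 * (1 + Real.log N) := by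
  refine le_trans ?_ (cell_le_log (by omega))
  exact_mod_cast intComplexity_le_size_pow_three (by omega) (by omega)

theorem maxVal_div_le_complexityWeight {n : ℕ} (hn : 2 ≤ n) :
    ((2 * maxVal (intComplexity (n - 1)) / n : ℕ) : ℝ) ≤ 2 * complexityWeight (n - 1) := by
  have hpos : (0 : ℝ) < (n - 1 : ℕ) := by exact_mod_cast (by omega : 0 < n - 1)
  calc ((2 * maxVal (intComplexity (n - 1)) / n : ℕ) : ℝ)
      ≤ ((2 * maxVal (intComplexity (n - 1)) : ℕ) : ℝ) / n := Nat.cast_div_le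
    _ ≤ 2 * (3 : ℝ) ^ ((intComplexity (n - 1) : ℝ) / 3) / (n - 1 : ℕ) := by
        push_cast
        gcongr
        · exact maxVal_le_rpow _
        · exact Nat.sub_le n 1
    _ = 2 * complexityWeight (n - 1) := by rw [complexityWeight, mul_div_assoc]

theorem roundCost_le {N n : ℕ} (hn : 2 ≤ n) (hN : n ≤ N) :
    (roundCost N n : ℝ) + 1 ≤
      235 * (1 + Real.log N) ^ 2 + 18 * complexityWeight (n - 1) + 9 * (N * (n : ℝ)⁻¹) := by
  have hcomp := intComplexity_pred_le_log hn hN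
  have hlog := Real.log_natCast_nonneg N
  have hdiv : ((N / n : ℕ) : ℝ) ≤ N * (n : ℝ)⁻¹ := Nat.cast_div_le
  rw [roundCost]
  push_cast
  have hsq : ((intComplexity (n - 1) : ℝ) + 14) * (intComplexity (n - 1) + 2) ≤
      (5 * (1 + Real.log N) + 14) * (5 * (1 + Real.log N) + 2) := by gcongr
  nlinarith [hsq, maxVal_div_le_complexityWeight hn]

theorem sum_complexityWeight_pred_le (N : ℕ) :
    ∑ n ∈ Finset.Ico 2 (N + 1), complexityWeight (n - 1) ≤ weightSum N := by
  rw [← Finset.sum_Ico_add' _ 1 N 1]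
  exact Finset.sum_le_sum_of_subset_of_nonneg Finset.Ico_subset_Icc_self fun n _ _ =>
    complexityWeight_nonneg n

theorem sum_inv_le_one_add_log (N : ℕ) :
    ∑ n ∈ Finset.Ico 2 (N + 1), (n : ℝ)⁻¹ ≤ 1 + Real.log N := by
  have h := harmonic_le_one_add_log N
  rw [harmonic_eq_sum_Icc] at h
  push_cast at h
  exact (Finset.sum_le_sum_of_subset_of_nonneg (Finset.Ico_subset_Ico_left one_le_two)
    fun _ _ _ => by positivity).trans h

theorem programCost_le {N : ℕ} (hN : 1 ≤ N) :
    (programCost N : ℝ) ≤ 275 * (N * (1 + Real.log N) ^ 2) + 18 * weightSum N := by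
  have hsum : ((∑ n ∈ Finset.Ico 2 (N + 1), (roundCost N n + 1) : ℕ) : ℝ) ≤
      N * (235 * (1 + Real.log N) ^ 2) + 18 * weightSum N + 9 * (N * (1 + Real.log N)) := by
    push_cast
    refine (Finset.sum_le_sum fun n hn => roundCost_le (Finset.mem_Ico.1 hn).1
      (Nat.lt_succ_iff.1 (Finset.mem_Ico.1 hn).2)).trans ?_
    rw [Finset.sum_add_distrib, Finset.sum_add_distrib, ← Finset.mul_sum _ _ (18 : ℝ),
      ← Finset.mul_sum _ _ (9 : ℝ), ← Finset.mul_sum _ _ (N : ℝ), Finset.sum_const, nsmul_eq_mul,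
      Nat.card_Ico]
    gcongr
    · exact Nat.sub_le_of_le_add (by omega)
    · exact sum_complexityWeight_pred_le N
    · exact sum_inv_le_one_add_log N
  have hsize : ((N ^ 3).size : ℝ) ≤ 5 * (1 + Real.log N) := cell_le_log hN
  have hN1 : (1 : ℝ) ≤ N := by exact_mod_cast hN
  have hy : 1 ≤ 1 + Real.log N := by linarith [Real.log_natCast_nonneg N]
  have hNy : (1 + Real.log N) ≤ N * (1 + Real.log N) := le_mul_of_one_le_left (by linarith) hN1
  have hNN : (N : ℝ) ≤ N * (1 + Real.log N) := le_mul_of_one_le_right (by linarith) hy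
  have hyy : N * (1 + Real.log N) ≤ N * (1 + Real.log N) ^ 2 := by gcongr; nlinarith
  rw [programCost, Nat.cast_add]
  push_cast at hsum ⊢
  linarith

theorem isBigO_weightSum {β : ℝ} (hβ : 1.23 ≤ β) :
    weightSum =O[atTop] fun N : ℕ => (N : ℝ) ^ β := by
  obtain ⟨C, hC, h⟩ := exists_weightSum_le
  refine .of_bound C ?_
  filter_upwards [eventually_ge_atTop 1] with N hN
  rw [Real.norm_of_nonneg (weightSum_nonneg N), Real.norm_of_nonneg (by positivity)]
  refine (h N).trans (mul_le_mul_of_nonneg_left ?_ hC)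
  exact Real.rpow_le_rpow_of_exponent_le (by exact_mod_cast hN) hβ

theorem isBigO_programCost {β : ℝ} (hβ : 1.23 < β) :
    (fun N : ℕ => (programCost N : ℝ)) =O[atTop] fun N : ℕ => (N : ℝ) ^ β := by
  have hlog := (isBigO_mul_one_add_log_sq (β := β) (by linarith)).comp_tendsto
    (tendsto_natCast_atTop_atTop (R := ℝ))
  refine .trans (.of_norm_eventuallyLE ?_)
    ((hlog.const_mul_left 275).add ((isBigO_weightSum hβ.le).const_mul_left 18))
  filter_upwards [eventually_ge_atTop 1] with N hN
  rw [Real.norm_natCast]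
  exact programCost_le hN

theorem within_input (N : ℕ) : (input N).Within (limits N) where
  reg_le r := by
    have hcube : N + 1 ≤ (N + 1) ^ 3 := Nat.le_self_pow three_ne_zero _
    have hval : (limits N).val = 2 * (N + 1) ^ 3 := rfl
    change (if r = Reg.nMax then N else 0) ≤ (limits N).val
    split_ifs <;> omega
  length_le := Nat.zero_le _
  mem_le := by simp [input]

end TimeImproved

theorem mainTheorem1 :
    ∃ (output : ℕ → Mem) (usage : ℕ → Usage),
      (∀ N : ℕ, 1 ≤ N →
        Exec TimeImproved.program (TimeImproved.input N) (output N) (usage N) ∧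
        ∀ n : ℕ, 1 ≤ n → n ≤ N → (output N).arr[n]? = some (intComplexity n)) ∧
      (fun N : ℕ => ((usage N).time : ℝ))
        =O[Filter.atTop] (fun N : ℕ => (N : ℝ) ^ (1.230175 : ℝ)) ∧
      (fun N : ℕ => ((usage N).space : ℝ))
        =O[Filter.atTop] (fun N : ℕ => (N : ℝ) * Real.log (Real.log (N : ℝ))) ∧
      (fun N : ℕ => ((usage N).width : ℝ))
        =O[Filter.atTop] (fun N : ℕ => Real.log (N : ℝ)) := by
  have : Nonempty Mem := ⟨TimeImproved.input 0⟩
  have : Nonempty Usage := ⟨⟨0, 0, 0⟩⟩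
  choose! output usage hexec htime hspace hwidth _ hout using fun N hN =>
    TimeImproved.runs_program (N := N) hN (TimeImproved.within_input N)
  have hlarge := eventually_ge_atTop 1
  exact ⟨output, usage, fun N hN => ⟨hexec N hN, hout N hN⟩,
    isBigO_natCast_of_eventually_le (hlarge.mono htime)
      (TimeImproved.isBigO_programCost (by norm_num)),
    isBigO_natCast_of_eventually_le (hlarge.mono hspace) TimeImproved.isBigO_space,
    isBigO_natCast_of_eventually_le (hlarge.mono hwidth) TimeImproved.isBigO_width⟩
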